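/- Set $\hbar=1$. A system with position and momentum $Q,P$ on $L^2(\mathbb R)$ is coupled to two probes with positions and momenta $Q_1,P_1,Q_2,P_2$ on $L^2(\mathbb R^2)$. Let $\lambda,\mu>0$, $\kappa\in\mathbb R$ and $$H=\lambda QP_1-\mu PQ_2+\tfrac{\lambda\mu}{2}\kappa P_1Q_2,\qquad U=\exp(-iH)\ \text{ on } L^2(\mathbb R^3).$$ ($U$ is the time-one member of the strongly continuous one-parameter unitary group whose generator is $-iH$ on Schwartz functions; it exists and is unique, also when $\lambda$ or $\mu$ is replaced by $0$.) Let the probes be in a state $\sigma=\sum_i p_i|\varphi_i\rangle\langle\varphi_i|$, where the sum is countable, $p_i\ge0$, $\sum_ip_i=1$ and the $\varphi_i\in L^2(\mathbb R^2)$ are unit vectors. Write $\tilde\varphi(p_1,p_2)=\frac1{2\pi}\int e^{-i(p_1q_1+p_2q_2)}\varphi(q_1,q_2)\,dq_1dq_2$ (Plancherel transform). Averages $\langle g(Q_1,Q_2)\rangle_\sigma$ and $\langle g(P_1,P_2)\rangle_\sigma$ are integrals of $g$ against the densities $\sum_ip_i|\varphi_i|^2$ and $\sum_ip_i|\tilde\varphi_i|^2$;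 further $\mathrm{Var}(A,\sigma)=\langle A^2\rangle_\sigma-\langle A\rangle_\sigma^2$ and $\mathrm{Cov}(A,B,\sigma)=\langle AB\rangle_\sigma-\langle A\rangle_\sigma\langle B\rangle_\sigma$. The observable $\mathsf G^{(\lambda,\mu)}$ of the system is defined by $$\langle\psi,\mathsf G^{(\lambda,\mu)}(X\times Y)\psi\rangle=\sum_ip_i\big\langle U(\psi\otimes\varphi_i),\,\big(I\otimes \mathsf E^{Q_1}(\lambda X)\otimes \mathsf E^{P_2}(\mu Y)\big)U(\psi\otimes\varphi_i)\big\rangle ,$$ where $\mathsf E^{Q_1},\mathsf E^{P_2}$ are the spectral measures of $Q_1,P_2$. Let $\mathsf E^{(\lambda,\mu)}(X)=\mathsf G^{(\lambda,\mu)}(X\times\mathbb R)$ and $\mathsf F^{(\lambda,\mu)}(Y)=\mathsf G^{(\lambda,\mu)}(\mathbb R\times Y)$. Let $\mathsf E^{(\lambda,0)}$ be the observable obtained with $\mu=0$ in $U$ by measuring only $\mathsf E^{Q_1}(\lambda X)$, and $\mathsf F^{(0,\mu)}$ the one obtained with $\lambda=0$ in $U$ by measuring only $\mathsf E^{P_2}(\mu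 Y)$. 1. **Marginals.** For all Borel sets $X,Y\subseteq\mathbb R$, $\mathsf E^{(\lambda,\mu)}(X)=(\chi_X*e)(Q)$ and $\mathsf F^{(\lambda,\mu)}(Y)=(\chi_Y*f)(P)$, with the probability densities $$e(q)=\frac\lambda\mu\sum_ip_i\int\Big|\varphi_i\big(\lambda(\tfrac12(1-\kappa)q'-q),\tfrac{q'}\mu\big)\Big|^2dq',\qquad f(p)=\frac\mu\lambda\sum_ip_i\int\Big|\tilde\varphi_i\big(\tfrac w\lambda,\mu(\tfrac w2(\kappa+1)-p)\big)\Big|^2dw .$$ Likewise $\mathsf E^{(\lambda,0)}(X)=(\chi_X*e_0)(Q)$ and $\mathsf F^{(0,\mu)}(Y)=(\chi_Y*f_0)(P)$ with the probability densities $e_0(q)=\lambda\sum_ip_i\int|\varphi_i(-\lambda q,q_2)|^2dq_2$ and $f_0(p)=\mu\sum_ip_i\int|\tilde\varphi_i(p_1,-\mu p)|^2dp_1$. 2. **Moments and variances.** If $Q_1,Q_2$ have finite first absolute moments in $\sigma$, then $e$ has a finite first moment $e[1]=\frac\mu2(1-\kappa)\langle Q_2\rangle_\sigma-\frac1\lambda\langle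 Q_1\rangle_\sigma$. If they have finite second moments, then so does $e$, and $$e[2]=\tfrac{\mu^2}4(1-\kappa)^2\langle Q_2^2\rangle_\sigma+\tfrac1{\lambda^2}\langle Q_1^2\rangle_\sigma-\tfrac\mu\lambda(1-\kappa)\langle Q_1Q_2\rangle_\sigma,$$ $$\mathrm{Var}(e)=\tfrac1{\lambda^2}\mathrm{Var}(Q_1,\sigma)+\tfrac{\mu^2}4(1-\kappa)^2\mathrm{Var}(Q_2,\sigma)-\tfrac\mu\lambda(1-\kappa)\mathrm{Cov}(Q_1,Q_2,\sigma),$$ and $\mathrm{Var}(e_0)=\lambda^{-2}\mathrm{Var}(Q_1,\sigma)$. Under the corresponding assumptions on $P_1,P_2$, $f[1]=\frac\lambda2(1+\kappa)\langle P_1\rangle_\sigma-\frac1\mu\langle P_2\rangle_\sigma$, $$f[2]=\tfrac{\lambda^2}4(1+\kappa)^2\langle P_1^2\rangle_\sigma+\tfrac1{\mu^2}\langle P_2^2\rangle_\sigma-\tfrac\lambda\mu(1+\kappa)\langle P_1P_2\rangle_\sigma,$$ $$\mathrm{Var}(f)=\tfrac{\lambda^2}4(1+\kappa)^2\mathrm{Var}(P_1,\sigma)+\tfrac1{\mu^2}\mathrm{Var}(P_2,\sigma)-\tfrac\lambda\mu(1+\kappa)\mathrm{Cov}(P_1,P_2,\sigma),$$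 and $\mathrm{Var}(f_0)=\mu^{-2}\mathrm{Var}(P_2,\sigma)$. 3. **Di Lorenzo's quantities.** For a unit vector $\psi\in L^2(\mathbb R)$ let $\mathrm{Var}(\mathsf A,\psi)$ be the variance of the outcome distribution $X\mapsto\langle\psi,\mathsf A(X)\psi\rangle$. If $Q_1,Q_2$ have finite second moments in $\sigma$ and $Q$ has a finite second moment in $\psi$, then $$\Delta_{DL}(Q):=\mathrm{Var}(\mathsf E^{(\lambda,\mu)},\psi)-\mathrm{Var}(\mathsf E^{(\lambda,0)},\psi)=\mathrm{Var}(e)-\mathrm{Var}(e_0)=\tfrac{(1-\kappa)^2}4\mu^2\,\mathrm{Var}(Q_2,\sigma)-\tfrac{1-\kappa}\lambda\mu\,\mathrm{Cov}(Q_1,Q_2,\sigma),$$ all variances being finite. If $P_1,P_2$ have finite second moments in $\sigma$ and $P$ in $\psi$, then $$\Delta_{DL}(P):=\mathrm{Var}(\mathsf F^{(\lambda,\mu)},\psi)-\mathrm{Var}(\mathsf F^{(0,\mu)},\psi)=\mathrm{Var}(f)-\mathrm{Var}(f_0)=\tfrac{(1+\kappa)^2}4\lambda^2\,\mathrm{Var}(P_1,\sigma)-\tfrac{1+\kappa}\mu\lambda\,\mathrm{Cov}(P_1,P_2,\sigma).$$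 4. **Negativity.** For all $\lambda,\mu>0$ and $\kappa\in\mathbb R$ there is a probe state $\sigma$, a mixture of two pure states with finite second moments of $Q_1,Q_2,P_1,P_2$ and with $\mathrm{Cov}(Q_1,Q_2,\sigma)\ne0\ne\mathrm{Cov}(P_1,P_2,\sigma)$, such that $\Delta_{DL}(Q)<0$ if $\kappa\ne1$, and $\Delta_{DL}(P)<0$ if $\kappa\ne-1$, for all unit vectors $\psi$ in which $Q$, respectively $P$, has a finite second moment. -/

import Mathlib

open MeasureTheory
open scoped SchwartzMap FourierTransform ENNReal Convolution Pointwise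

namespace ArthursKelly

noncomputable section

/-! Planck's constant is `1`.  The system has configuration space `ℝ`, the two probes together have
`EuclideanSpace ℝ (Fin 2)` (coordinates `q₁ = x 0`, `q₂ = x 1`), and the three particles together
have `EuclideanSpace ℝ (Fin 3)` (coordinates `q = x 0`, `q₁ = x 1`, `q₂ = x 2`). -/

/-- The configuration space of `n` particles on the line. -/
abbrev Conf (n : ℕ) : Type := EuclideanSpace ℝ (Fin n)

/-- The Hilbert space `L²(E)` of complex square-integrable functions. -/
abbrev L2 (E : Type*) [NormedAddCommGroup E] [InnerProductSpace ℝ E] [FiniteDimensional ℝ E]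
    [MeasurableSpace E] [BorelSpace E] : Type _ := Lp ℂ 2 (volume : Measure E)

/-! ### The coupling `U = exp(-iH)` -/

/-- The position operator `Q_j` on Schwartz functions. -/
def posOp {n : ℕ} (j : Fin n) : 𝓢(Conf n, ℂ) →L[ℂ] 𝓢(Conf n, ℂ) :=
  SchwartzMap.smulLeftCLM ℂ (fun x : Conf n => ((x j : ℝ) : ℂ))

theorem posOp_apply {n : ℕ} (j : Fin n) (f : 𝓢(Conf n, ℂ)) (x : Conf n) :
    posOp j f x = (x j : ℂ) * f x := by
  have h : Function.HasTemperateGrowth (fun x : Conf n => ((x j : ℝ) : ℂ)) :=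
    (Complex.ofRealCLM.comp (EuclideanSpace.proj j : Conf n →L[ℝ] ℝ)).hasTemperateGrowth
  simp [posOp, SchwartzMap.smulLeftCLM_apply_apply h]

/-- The momentum operator `P_j = -i ∂_j` on Schwartz functions. -/
def momOp {n : ℕ} (j : Fin n) : 𝓢(Conf n, ℂ) →L[ℂ] 𝓢(Conf n, ℂ) :=
  (-Complex.I) • LineDeriv.lineDerivOpCLM ℂ 𝓢(Conf n, ℂ) (EuclideanSpace.single j (1 : ℝ))

/-- The interaction Hamiltonian `H = lam Q P₁ - mu P Q₂ + (lam mu / 2) kap P₁ Q₂`. -/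
def hamiltonian (lam mu kap : ℝ) : 𝓢(Conf 3, ℂ) →L[ℂ] 𝓢(Conf 3, ℂ) :=
  (lam : ℂ) • (posOp 0 ∘L momOp 1) - (mu : ℂ) • (momOp 0 ∘L posOp 2)
    + ((lam * mu / 2 * kap : ℝ) : ℂ) • (momOp 1 ∘L posOp 2)

/-- `U = exp(-iH)`: `U` is the time-one member of a strongly continuous one-parameter unitary group
on `L²` whose generator is `-iH` on the Schwartz functions. -/
def IsExpNegI {n : ℕ} (H : 𝓢(Conf n, ℂ) →L[ℂ] 𝓢(Conf n, ℂ))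
    (U : L2 (Conf n) ≃ₗᵢ[ℂ] L2 (Conf n)) : Prop :=
  ∃ V : ℝ → (L2 (Conf n) ≃ₗᵢ[ℂ] L2 (Conf n)),
    (∀ s t, V (s + t) = V s * V t) ∧
    (∀ ψ, Continuous fun t => V t ψ) ∧
    (∀ f : 𝓢(Conf n, ℂ), HasDerivAt (fun t => V t (f.toLp 2 volume))
      ((-Complex.I) • (H f).toLp 2 volume) 0) ∧
    V 1 = U

/-- The coupling unitary `U = exp(-iH)`. -/
def coupling (lam mu kap : ℝ) : L2 (Conf 3) ≃ₗᵢ[ℂ] L2 (Conf 3) :=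
  Classical.epsilon (IsExpNegI (hamiltonian lam mu kap))

/-! ### Position, momentum and their spectral measures -/

open Classical in
/-- Multiplication by the indicator function of `S` on `L²(E)` (for measurable `S`). -/
def indicatorOp {E : Type*} [NormedAddCommGroup E] [InnerProductSpace ℝ E]
    [FiniteDimensional ℝ E] [MeasurableSpace E] [BorelSpace E] (S : Set E) : L2 E →L[ℂ] L2 E :=
  if hS : MeasurableSet S then
    (ContinuousLinearMap.mul ℂ ℂ).holderL volume ∞ 2 2
      ((memLp_top_of_bound (f := S.indicator (fun _ => (1 : ℂ)))
        ((measurable_const.indicator hS).aestronglyMeasurable) 1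
        (Filter.Eventually.of_forall fun x => by
          by_cases h : x ∈ S <;> simp [h])).toLp _)
  else 0

/-- The spectral projection `E^{Q_j}(X)` of the position `Q_j`. -/
def posProj {n : ℕ} (j : Fin n) (X : Set ℝ) : L2 (Conf n) →L[ℂ] L2 (Conf n) :=
  indicatorOp {x : Conf n | x j ∈ X}

/-- The Fourier transform on `L²(ℝⁿ)`, with kernel `exp(-2πi⟨x, ξ⟩)`; the momentum is `2πξ`. -/
def fourierL2 (n : ℕ) : L2 (Conf n) ≃ₗᵢ[ℂ] L2 (Conf n) := Lp.fourierTransformₗᵢ (Conf n) ℂ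

/-- The spectral projection `E^{P_j}(Y)` of the momentum `P_j`. -/
def momProj {n : ℕ} (j : Fin n) (Y : Set ℝ) : L2 (Conf n) →L[ℂ] L2 (Conf n) :=
  (fourierL2 n).symm.toContinuousLinearEquiv.toContinuousLinearMap ∘L
    indicatorOp {ξ : Conf n | 2 * Real.pi * ξ j ∈ Y} ∘L
      (fourierL2 n).toContinuousLinearEquiv.toContinuousLinearMap

section Wave

variable {E : Type*} [NormedAddCommGroup E] [InnerProductSpace ℝ E] [FiniteDimensional ℝ E]
  [MeasurableSpace E] [BorelSpace E]

/-- The momentum-space wave function `φ̃(p) = (2π)^{-d/2} ∫ exp(-i⟨p, x⟩) φ(x) dx` of `φ ∈ L²(E)`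
(in the sense of Plancherel), `d = dim E`. -/
def momWave (φ : L2 E) (p : E) : ℂ :=
  (((2 * Real.pi) ^ (-(Module.finrank ℝ E : ℝ) / 2) : ℝ) : ℂ) *
    (Lp.fourierTransformₗᵢ E ℂ φ : L2 E) ((2 * Real.pi)⁻¹ • p)

/-- The position distribution of the vector state `φ`. -/
def posLaw (φ : L2 E) : Measure E := volume.withDensity fun x => ‖φ x‖ₑ ^ 2

/-- The momentum distribution of the vector state `φ`. -/
def momLaw (φ : L2 E) : Measure E := volume.withDensity fun p => ‖momWave φ p‖ₑ ^ 2

end Wave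

/-- `T = g(Q)` on `L²(ℝ)`. -/
def IsFunOfPos (T : L2 ℝ →L[ℂ] L2 ℝ) (g : ℝ → ℝ) : Prop :=
  ∀ ψ : L2 ℝ, (T ψ : ℝ → ℂ) =ᵐ[volume] fun x => (g x : ℂ) * ψ x

/-- `T = g(P)` on `L²(ℝ)`. -/
def IsFunOfMom (T : L2 ℝ →L[ℂ] L2 ℝ) (g : ℝ → ℝ) : Prop :=
  ∀ ψ : L2 ℝ, momWave (T ψ) =ᵐ[volume] fun p => (g p : ℂ) * momWave ψ p

/-! ### Probe states -/

/-- A state `σ = ∑ᵢ pᵢ |φᵢ⟩⟨φᵢ|` of the two probes: a (countable) mixture of arbitrary pure states.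
Every density operator is of this form. -/
structure ProbeState (ι : Type*) where
  weight : ι → ℝ
  vec : ι → L2 (Conf 2)
  weight_nonneg : ∀ i, 0 ≤ weight i
  weight_sum : HasSum weight 1
  norm_vec : ∀ i, ‖vec i‖ = 1

namespace ProbeState

variable {ι : Type*} (σ : ProbeState ι)

/-- The joint distribution of `(Q₁, Q₂)` in the state `σ`. -/
def posLaw : Measure (Conf 2) :=
  Measure.sum fun i => ENNReal.ofReal (σ.weight i) • ArthursKelly.posLaw (σ.vec i)

/-- The joint distribution of `(P₁, P₂)` in the state `σ`. -/
def momLaw : Measure (Conf 2) :=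
  Measure.sum fun i => ENNReal.ofReal (σ.weight i) • ArthursKelly.momLaw (σ.vec i)

/-- `⟨g(Q₁, Q₂)⟩_σ`. -/
def avgQ (g : Conf 2 → ℝ) : ℝ := ∫ x, g x ∂σ.posLaw

/-- `⟨g(P₁, P₂)⟩_σ`. -/
def avgP (g : Conf 2 → ℝ) : ℝ := ∫ p, g p ∂σ.momLaw

/-- `Var(Q_j, σ) = ⟨Q_j²⟩ - ⟨Q_j⟩²`. -/
def varQ (j : Fin 2) : ℝ := σ.avgQ (fun x => x j ^ 2) - σ.avgQ (fun x => x j) ^ 2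

/-- `Var(P_j, σ) = ⟨P_j²⟩ - ⟨P_j⟩²`. -/
def varP (j : Fin 2) : ℝ := σ.avgP (fun p => p j ^ 2) - σ.avgP (fun p => p j) ^ 2

/-- `Cov(Q₁, Q₂, σ) = ⟨Q₁ Q₂⟩ - ⟨Q₁⟩⟨Q₂⟩`. -/
def covQ : ℝ := σ.avgQ (fun x => x 0 * x 1) - σ.avgQ (fun x => x 0) * σ.avgQ (fun x => x 1)

/-- `Cov(P₁, P₂, σ) = ⟨P₁ P₂⟩ - ⟨P₁⟩⟨P₂⟩`. -/
def covP : ℝ := σ.avgP (fun p => p 0 * p 1) - σ.avgP (fun p => p 0) * σ.avgP (fun p => p 1)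

/-- `Q₁` and `Q₂` have finite first absolute moments. -/
def FirstMomentsQ : Prop := ∀ j : Fin 2, Integrable (fun x : Conf 2 => x j) σ.posLaw

/-- `P₁` and `P₂` have finite first absolute moments. -/
def FirstMomentsP : Prop := ∀ j : Fin 2, Integrable (fun p : Conf 2 => p j) σ.momLaw

/-- `Q₁` and `Q₂` have finite second moments. -/
def SecondMomentsQ : Prop := ∀ j : Fin 2, Integrable (fun x : Conf 2 => x j ^ 2) σ.posLaw

/-- `P₁` and `P₂` have finite second moments. -/
def SecondMomentsP : Prop := ∀ j : Fin 2, Integrable (fun p : Conf 2 => p j ^ 2) σ.momLaw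

end ProbeState

/-! ### The effective observables -/

/-- The splitting `(q, q₁, q₂) ↦ (q, (q₁, q₂))`. -/
def split (x : Conf 3) : ℝ × Conf 2 := (x 0, !₂[x 1, x 2])

theorem measurePreserving_split : MeasurePreserving split volume volume := by
  have h1 := PiLp.volume_preserving_ofLp (Fin 3)
  have h2 := volume_preserving_piFinSuccAbove (fun _ : Fin 3 => ℝ) 0
  have h3 := (MeasurePreserving.id (volume : Measure ℝ)).prod (PiLp.volume_preserving_toLp (Fin 2))
  have h := h3.comp (h2.comp h1)
  have he : split = Prod.map id (WithLp.toLp 2) ∘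
      ⇑(MeasurableEquiv.piFinSuccAbove (fun _ : Fin 3 => ℝ) 0) ∘ WithLp.ofLp := by
    funext x
    refine Prod.ext rfl ?_
    ext i
    fin_cases i <;> rfl
  rw [he]
  exact h

theorem aesm_prod (ψ : L2 ℝ) (φ : L2 (Conf 2)) :
    AEStronglyMeasurable (fun y : ℝ × Conf 2 => ψ y.1 * φ y.2) (volume.prod volume) :=
  (Lp.aestronglyMeasurable ψ).comp_fst.mul (Lp.aestronglyMeasurable φ).comp_snd

theorem eLpNorm_prod (ψ : L2 ℝ) (φ : L2 (Conf 2)) :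
    eLpNorm (fun y : ℝ × Conf 2 => ψ y.1 * φ y.2) 2 (volume.prod volume)
      = eLpNorm ψ 2 volume * eLpNorm φ 2 volume := by
  have h0 : (0 : ℝ) ≤ (2 : ℝ≥0∞).toReal := ENNReal.toReal_nonneg
  have key := lintegral_prod_mul (μ := (volume : Measure ℝ)) (ν := (volume : Measure (Conf 2)))
    ((Lp.aestronglyMeasurable ψ).enorm.pow_const (2 : ℝ≥0∞).toReal)
    ((Lp.aestronglyMeasurable φ).enorm.pow_const (2 : ℝ≥0∞).toReal)
  rw [eLpNorm_eq_lintegral_rpow_enorm_toReal two_ne_zero ENNReal.ofNat_ne_top,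
    eLpNorm_eq_lintegral_rpow_enorm_toReal two_ne_zero ENNReal.ofNat_ne_top,
    eLpNorm_eq_lintegral_rpow_enorm_toReal two_ne_zero ENNReal.ofNat_ne_top,
    ← ENNReal.mul_rpow_of_nonneg _ _ (by positivity), ← key]
  simp only [enorm_mul, ENNReal.mul_rpow_of_nonneg _ _ h0]

theorem eLpNorm_tensor (ψ : L2 ℝ) (φ : L2 (Conf 2)) :
    eLpNorm (fun x : Conf 3 => ψ (x 0) * φ !₂[x 1, x 2]) 2 volume
      = eLpNorm ψ 2 volume * eLpNorm φ 2 volume :=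
  (eLpNorm_comp_measurePreserving (aesm_prod ψ φ) measurePreserving_split).trans (eLpNorm_prod ψ φ)

theorem memLp_tensor (ψ : L2 ℝ) (φ : L2 (Conf 2)) :
    MemLp (fun x : Conf 3 => ψ (x 0) * φ !₂[x 1, x 2]) 2 volume := by
  refine ⟨(aesm_prod ψ φ).comp_measurePreserving measurePreserving_split, ?_⟩
  rw [eLpNorm_tensor]
  exact ENNReal.mul_lt_top (Lp.eLpNorm_lt_top ψ) (Lp.eLpNorm_lt_top φ)

/-- The vector `ψ ⊗ φ`, i.e. the function `(q, q₁, q₂) ↦ ψ(q) φ(q₁, q₂)`. -/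
def tensor (ψ : L2 ℝ) (φ : L2 (Conf 2)) : L2 (Conf 3) := (memLp_tensor ψ φ).toLp _

theorem ae_comp_fst {p : ℝ → Prop} (h : ∀ᵐ y, p y) : ∀ᵐ x : Conf 3, p (x 0) :=
  (Measure.quasiMeasurePreserving_fst.comp
    measurePreserving_split.quasiMeasurePreserving).ae h

/-- The bounded operator `ψ ↦ ψ ⊗ φ`. -/
def tensorL (φ : L2 (Conf 2)) : L2 ℝ →L[ℂ] L2 (Conf 3) :=
  LinearMap.mkContinuous
    { toFun := fun ψ => tensor ψ φ
      map_add' := fun ψ χ => by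
        unfold tensor
        rw [← MemLp.toLp_add]
        refine MemLp.toLp_congr _ _ ?_
        filter_upwards [ae_comp_fst (Lp.coeFn_add ψ χ)] with x hx
        rw [hx]; exact add_mul _ _ _
      map_smul' := fun c ψ => by
        unfold tensor
        rw [RingHom.id_apply, ← MemLp.toLp_const_smul]
        refine MemLp.toLp_congr _ _ ?_
        filter_upwards [ae_comp_fst (Lp.coeFn_smul c ψ)] with x hx
        rw [hx]; exact mul_assoc _ _ _ }
    ‖φ‖ (fun ψ => by
      change ‖tensor ψ φ‖ ≤ _
      rw [tensor, Lp.norm_toLp, eLpNorm_tensor, ENNReal.toReal_mul, mul_comm,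
        Lp.norm_def, Lp.norm_def])

/-- The operator `A` on the system with
`⟨ψ, A ψ⟩ = tr[U (|ψ⟩⟨ψ| ⊗ σ) U* M] = ∑ᵢ pᵢ ⟨U (ψ ⊗ φᵢ), M U (ψ ⊗ φᵢ)⟩`:
the effect measured on the system when, after the coupling `U` with probes in the state `σ`,
the effect `M` is measured. -/
def effective {ι : Type*} (U : L2 (Conf 3) ≃ₗᵢ[ℂ] L2 (Conf 3)) (σ : ProbeState ι)
    (M : L2 (Conf 3) →L[ℂ] L2 (Conf 3)) : L2 ℝ →L[ℂ] L2 ℝ :=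
  ∑' i, (σ.weight i : ℂ) •
    (ContinuousLinearMap.adjoint
        (U.toContinuousLinearEquiv.toContinuousLinearMap ∘L tensorL (σ.vec i)) ∘L
      M ∘L (U.toContinuousLinearEquiv.toContinuousLinearMap ∘L tensorL (σ.vec i)))

variable {ι : Type*}

/-- The phase space observable `G(X × Y)`: after the coupling, the position of probe 1 is found in
`lam X` and the momentum of probe 2 in `mu Y`. -/
def obsG (lam mu kap : ℝ) (σ : ProbeState ι) (X Y : Set ℝ) : L2 ℝ →L[ℂ] L2 ℝ :=
  effective (coupling lam mu kap) σ (posProj 1 (lam • X) ∘L momProj 2 (mu • Y))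

/-- The position marginal `E(X) = G(X × ℝ)`. -/
def obsE (lam mu kap : ℝ) (σ : ProbeState ι) (X : Set ℝ) : L2 ℝ →L[ℂ] L2 ℝ :=
  obsG lam mu kap σ X Set.univ

/-- The momentum marginal `F(Y) = G(ℝ × Y)`. -/
def obsF (lam mu kap : ℝ) (σ : ProbeState ι) (Y : Set ℝ) : L2 ℝ →L[ℂ] L2 ℝ :=
  obsG lam mu kap σ Set.univ Y

/-- The observable measured with the first probe alone, at coupling `mu = 0`. -/
def obsE0 (lam kap : ℝ) (σ : ProbeState ι) (X : Set ℝ) : L2 ℝ →L[ℂ] L2 ℝ :=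
  effective (coupling lam 0 kap) σ (posProj 1 (lam • X))

/-- The observable measured with the second probe alone, at coupling `lam = 0`. -/
def obsF0 (mu kap : ℝ) (σ : ProbeState ι) (Y : Set ℝ) : L2 ℝ →L[ℂ] L2 ℝ :=
  effective (coupling 0 mu kap) σ (momProj 2 (mu • Y))

/-! ### The noise densities -/

/-- The density `e` of the position noise. -/
def noiseE (lam mu kap : ℝ) (σ : ProbeState ι) (q : ℝ) : ℝ :=
  lam / mu * ∑' i, σ.weight i *
    ∫ q' : ℝ, ‖σ.vec i !₂[lam * ((1 - kap) / 2 * q' - q), q' / mu]‖ ^ 2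

/-- The density `f` of the momentum noise. -/
def noiseF (lam mu kap : ℝ) (σ : ProbeState ι) (p : ℝ) : ℝ :=
  mu / lam * ∑' i, σ.weight i *
    ∫ w : ℝ, ‖momWave (σ.vec i) !₂[w / lam, mu * (w / 2 * (kap + 1) - p)]‖ ^ 2

/-- The density of the position noise for the first probe alone. -/
def noiseE0 (lam : ℝ) (σ : ProbeState ι) (q : ℝ) : ℝ :=
  lam * ∑' i, σ.weight i * ∫ q₂ : ℝ, ‖σ.vec i !₂[-(lam * q), q₂]‖ ^ 2

/-- The density of the momentum noise for the second probe alone. -/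
def noiseF0 (mu : ℝ) (σ : ProbeState ι) (p : ℝ) : ℝ :=
  mu * ∑' i, σ.weight i * ∫ p₁ : ℝ, ‖momWave (σ.vec i) !₂[p₁, -(mu * p)]‖ ^ 2

/-- `e` is a probability density on `ℝ`. -/
def IsProbDensity (e : ℝ → ℝ) : Prop := (∀ q, 0 ≤ e q) ∧ Integrable e ∧ ∫ q, e q = 1

/-- The smeared indicator function `χ_X * e`. -/
def smear (X : Set ℝ) (e : ℝ → ℝ) : ℝ → ℝ :=
  X.indicator (fun _ => (1 : ℝ)) ⋆[ContinuousLinearMap.mul ℝ ℝ, volume] e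

/-- The first moment `e[1]`. -/
def moment1 (e : ℝ → ℝ) : ℝ := ∫ q, q * e q

/-- The second moment `e[2]`. -/
def moment2 (e : ℝ → ℝ) : ℝ := ∫ q, q ^ 2 * e q

/-- The variance of the probability density `e`. -/
def densityVar (e : ℝ → ℝ) : ℝ := ∫ q, (q - moment1 e) ^ 2 * e q

/-! ### Measurement statistics and Di Lorenzo's quantities -/

/-- `ν` is the outcome distribution of the observable `A` in the vector state `ψ`:
`ν(X) = ⟨ψ, A(X) ψ⟩`. -/
def IsOutcomeLaw (A : Set ℝ → (L2 ℝ →L[ℂ] L2 ℝ)) (ψ : L2 ℝ) (ν : Measure ℝ) : Prop :=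
  IsProbabilityMeasure ν ∧ ∀ X, MeasurableSet X → ((ν.real X : ℝ) : ℂ) = inner ℂ ψ (A X ψ)

/-- The outcome distribution of the observable `A` in the vector state `ψ`. -/
def outcomeLaw (A : Set ℝ → (L2 ℝ →L[ℂ] L2 ℝ)) (ψ : L2 ℝ) : Measure ℝ :=
  Classical.epsilon (IsOutcomeLaw A ψ)

/-- The statement that the outcomes of `A` in the state `ψ` have a distribution, with finite second
moment. -/
def HasFiniteVar (A : Set ℝ → (L2 ℝ →L[ℂ] L2 ℝ)) (ψ : L2 ℝ) : Prop :=
  (∃! ν, IsOutcomeLaw A ψ ν) ∧ Integrable (fun x => x ^ 2) (outcomeLaw A ψ)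

/-- `Var(A, ψ)`, the variance of the outcomes of `A` in the state `ψ`. -/
def obsVar (A : Set ℝ → (L2 ℝ →L[ℂ] L2 ℝ)) (ψ : L2 ℝ) : ℝ :=
  ∫ x, (x - ∫ y, y ∂outcomeLaw A ψ) ^ 2 ∂outcomeLaw A ψ

/-- Di Lorenzo's quantity `Δ_DL(Q)` in the system state `ψ`. -/
def deltaQ (lam mu kap : ℝ) (σ : ProbeState ι) (ψ : L2 ℝ) : ℝ :=
  obsVar (obsE lam mu kap σ) ψ - obsVar (obsE0 lam kap σ) ψ

/-- Di Lorenzo's quantity `Δ_DL(P)` in the system state `ψ`. -/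
def deltaP (lam mu kap : ℝ) (σ : ProbeState ι) (ψ : L2 ℝ) : ℝ :=
  obsVar (obsF lam mu kap σ) ψ - obsVar (obsF0 mu kap σ) ψ

end

end ArthursKelly

open ArthursKelly

namespace ArthursKelly

noncomputable section

/-! ### Differentiation of families in `L²` -/

/-! On Schwartz functions `-iH` is differentiation along a linear vector field on `ℝ³`: each
momentum in `H` is multiplied only by the position of another particle, so no ordering terms arise.
The field is nilpotent and trace free. Its flow is therefore polynomial in time and preserves
volume, and `exp(-itH)` is composition with that flow. This group leaves the Schwartz functions
invariant, which makes it the only unitary group with this generator (`unitaryGroup_unique`). Thus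
`coupling` is an explicit linear substitution, also when one coupling constant vanishes; on the
Fourier side it is the contragredient substitution (`fourier_flowUnitary`).

Read backwards through the substitution, the scaled outcome of probe 1 is `Q - noiseQ(Q₁, Q₂)` and
that of probe 2 is `P - noiseP(P₁, P₂)`, with linear functions `noiseQ` and `noiseP` of the initial
probe variables. In a product state system and probes are independent, so each outcome is the system
variable minus an independent noise whose law is the image of the probe distribution
(`hasNoiseLaw_posProj`, `hasNoiseLaw_momProj`). Averaging the indicator of `X` over the noise gives
the convolution, and polarization passes from expectation values to operators. Linear coordinates in
which the noise is the first variable yield the densities (`isDensityOf_map_mix`).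

The moments of the densities are then moments of linear forms in the probe variables. Variances of
independent variables add, so the variance of the system cancels in Di Lorenzo's differences and
only the difference of the noise variances remains (`HasNoiseLaw.obsVar_sub`).

For negativity, mix two opposite phase space displacements of one Schwartz state. Means stay fixed
and the second moments gain products of displacement components. Displacing one variable by a fixed
amount and the other freely fixes the relevant variance while the covariance takes any prescribed
value; position and momentum displacements can be chosen independently. -/

/-- Dominated convergence in `L²`. -/
theorem tendsto_toLp_two_of_dominated {α ι : Type*} [MeasurableSpace α] {μ : Measure α}
    {l : Filter ι} [l.IsCountablyGenerated] {F : ι → α → ℂ} {G : α → ℂ}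
    (hF : ∀ i, MemLp (F i) 2 μ) (hG : MemLp G 2 μ) {b : α → ℝ} (hb : MemLp b 2 μ)
    (hbound : ∀ᶠ i in l, ∀ x, ‖F i x‖ ≤ b x)
    (hlim : ∀ x, Filter.Tendsto (fun i => F i x) l (nhds (G x))) :
    Filter.Tendsto (fun i => (hF i).toLp (F i)) l (nhds (hG.toLp G)) := by
  rw [Lp.tendsto_Lp_iff_tendsto_eLpNorm'']
  have hb' : MemLp (fun x => b x + ‖G x‖) 2 μ := hb.add hG.norm
  have key : Filter.Tendsto (fun i => ∫⁻ x, ‖F i x - G x‖ₑ ^ (2 : ℝ) ∂μ) l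
      (nhds (∫⁻ _, 0 ∂μ)) := by
    refine tendsto_lintegral_filter_of_dominated_convergence'
      (fun x => ‖b x + ‖G x‖‖ₑ ^ (2 : ℝ)) ?_ ?_ ?_ ?_
    · exact Filter.Eventually.of_forall fun i =>
        ((hF i).1.sub hG.1).enorm.pow_const _
    · filter_upwards [hbound] with i hi
      refine Filter.Eventually.of_forall fun x => ?_
      refine ENNReal.rpow_le_rpow ?_ (by norm_num)
      rw [enorm_le_iff_norm_le]
      calc ‖F i x - G x‖ ≤ ‖F i x‖ + ‖G x‖ := norm_sub_le _ _
        _ ≤ b x + ‖G x‖ := by gcongr; exact hi x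
        _ ≤ _ := Real.le_norm_self _
    · have := hb'.eLpNorm_lt_top
      have h2 := lintegral_rpow_enorm_lt_top_of_eLpNorm_lt_top two_ne_zero ENNReal.ofNat_ne_top this
      simpa using h2.ne
    · refine Filter.Eventually.of_forall fun x => ?_
      have h1 : Filter.Tendsto (fun i => F i x - G x) l (nhds 0) := by
        simpa using (hlim x).sub_const (G x)
      have h2 : Filter.Tendsto (fun i => ‖F i x - G x‖ₑ) l (nhds 0) := by
        simpa using h1.enorm
      have h3 := (ENNReal.continuous_rpow_const (y := 2)).tendsto (0 : ℝ≥0∞)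
      rw [ENNReal.zero_rpow_of_pos (by norm_num)] at h3
      exact h3.comp h2
  have h4 := (ENNReal.continuous_rpow_const (y := 1 / 2)).tendsto (∫⁻ _ : α, 0 ∂μ)
  have h5 := h4.comp key
  simp only [lintegral_zero] at h5
  rw [ENNReal.zero_rpow_of_pos (by norm_num)] at h5
  refine h5.congr fun i => ?_
  rw [eLpNorm_eq_lintegral_rpow_enorm_toReal two_ne_zero ENNReal.ofNat_ne_top]
  simp

/-- The hypothesis `hbound` dominates all difference quotients near `0` by the single
square-integrable function `b`, so their pointwise limit is also their limit in `L²`. -/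
theorem hasDerivAt_toLp_two_of_dominated {α : Type*} [MeasurableSpace α] {μ : Measure α}
    {F : ℝ → α → ℂ} {G : α → ℂ} (hF : ∀ t, MemLp (F t) 2 μ) (hG : MemLp G 2 μ) {b : α → ℝ}
    (hb : MemLp b 2 μ) (hbound : ∀ t, |t| ≤ 1 → ∀ x, ‖F t x - F 0 x‖ ≤ |t| * b x)
    (hderiv : ∀ x, HasDerivAt (fun t => F t x) (G x) 0) :
    HasDerivAt (fun t => (hF t).toLp (F t)) (hG.toLp G) 0 := by
  have hS : ∀ t : ℝ, MemLp (t⁻¹ • (F (0 + t) - F 0)) 2 μ :=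
    fun t => ((hF (0 + t)).sub (hF 0)).const_smul t⁻¹
  have hle : ∀ᶠ t : ℝ in nhdsWithin 0 {0}ᶜ, ∀ x, ‖(t⁻¹ • (F (0 + t) - F 0)) x‖ ≤ b x := by
    have h1 : ∀ᶠ t : ℝ in nhdsWithin 0 {0}ᶜ, |t| < 1 := by
      refine Filter.Eventually.filter_mono nhdsWithin_le_nhds ?_
      filter_upwards [Metric.ball_mem_nhds (0 : ℝ) one_pos] with t ht
      simpa using ht
    filter_upwards [h1, self_mem_nhdsWithin] with t ht ht0 x
    have ht0' : 0 < |t| := abs_pos.2 ht0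
    rw [Pi.smul_apply, Pi.sub_apply, norm_smul, norm_inv, Real.norm_eq_abs, zero_add,
      inv_mul_le_iff₀ ht0']
    exact hbound t ht.le x
  have hlim : ∀ x, Filter.Tendsto (fun t : ℝ => (t⁻¹ • (F (0 + t) - F 0)) x)
      (nhdsWithin 0 {0}ᶜ) (nhds (G x)) := by
    intro x
    have h1 := hasDerivAt_iff_tendsto_slope_zero.1 (hderiv x)
    simpa only [Pi.smul_apply, Pi.sub_apply] using h1
  have h := tendsto_toLp_two_of_dominated (F := fun t : ℝ => t⁻¹ • (F (0 + t) - F 0))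
    hS hG hb hle hlim
  rw [hasDerivAt_iff_tendsto_slope_zero]
  refine h.congr fun t => ?_
  rw [MemLp.toLp_const_smul t⁻¹ ((hF (0 + t)).sub (hF 0)), MemLp.toLp_sub (hF (0 + t)) (hF 0)]

/-! ### Linear changes of variables -/

theorem map_volume_matrix {n : ℕ} (M : Matrix (Fin n) (Fin n) ℝ) (hM : M.det ≠ 0) :
    Measure.map (fun x : Conf n => WithLp.toLp 2 (M.mulVec (WithLp.ofLp x))) volume
      = ENNReal.ofReal |M.det⁻¹| • volume := by
  have h1 := (PiLp.volume_preserving_ofLp (Fin n)).map_eq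
  have h2 := Real.map_matrix_volume_pi_eq_smul_volume_pi hM
  have h3 := (PiLp.volume_preserving_toLp (Fin n)).map_eq
  have hm : Measurable (Matrix.toLin' M) :=
    (Matrix.toLin' M).continuous_of_finiteDimensional.measurable
  have he : (fun x : Conf n => (WithLp.toLp 2 (M.mulVec (WithLp.ofLp x)) : Conf n)) =
      WithLp.toLp 2 ∘ (Matrix.toLin' M ∘ WithLp.ofLp) := by
    funext x; simp
  rw [he, ← Measure.map_map (PiLp.volume_preserving_toLp (Fin n)).measurable
    (hm.comp (PiLp.volume_preserving_ofLp (Fin n)).measurable),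
    ← Measure.map_map hm (PiLp.volume_preserving_ofLp (Fin n)).measurable, h1, h2,
    Measure.map_smul, h3]

/-! ### The linear flow generated by the Hamiltonian -/

/-- The time-`t` flow on configuration space of the vector field
`x ↦ (mu x₂, -lam x₀ - (lam mu kap / 2) x₂, 0)`. -/
def flowFun (lam mu kap t : ℝ) (x : Conf 3) : Conf 3 :=
  !₂[x 0 + t * mu * x 2,
    x 1 - t * lam * x 0 - (t * lam * mu * kap / 2 + t ^ 2 * lam * mu / 2) * x 2, x 2]

/-- The generating matrix `A` satisfies `A³ = 0`, so `exp(tA) = 1 + tA + t²A²/2`. The only nonzero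
entry of `A²` produces the term `t² lam mu / 2` in `flowFun`. -/
theorem flowFun_flowFun (lam mu kap s t : ℝ) (x : Conf 3) :
    flowFun lam mu kap s (flowFun lam mu kap t x) = flowFun lam mu kap (s + t) x := by
  ext i
  fin_cases i <;> simp [flowFun] <;> ring

theorem flowFun_zero (lam mu kap : ℝ) (x : Conf 3) : flowFun lam mu kap 0 x = x := by
  ext i
  fin_cases i <;> simp [flowFun]

/-- The flow as a continuous linear equivalence. -/
def flow (lam mu kap t : ℝ) : Conf 3 ≃L[ℝ] Conf 3 :=
  LinearEquiv.toContinuousLinearEquiv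
    { toFun := flowFun lam mu kap t
      invFun := flowFun lam mu kap (-t)
      left_inv := fun x => by rw [flowFun_flowFun, neg_add_cancel, flowFun_zero]
      right_inv := fun x => by rw [flowFun_flowFun, add_neg_cancel, flowFun_zero]
      map_add' := fun x y => by
        ext i
        fin_cases i <;> simp [flowFun] <;> ring
      map_smul' := fun c x => by
        ext i
        fin_cases i <;> simp [flowFun] <;> ring }

theorem coe_flow (lam mu kap t : ℝ) : ⇑(flow lam mu kap t) = flowFun lam mu kap t := rfl

/-- The generator has trace zero, so the flow has determinant one and composition with it is unitary
without a Jacobian factor. -/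
theorem measurePreserving_flow (lam mu kap t : ℝ) :
    MeasurePreserving (flow lam mu kap t) volume volume := by
  refine ⟨(flow lam mu kap t).continuous.measurable, ?_⟩
  set M : Matrix (Fin 3) (Fin 3) ℝ := !![1, 0, t * mu;
    -(t * lam), 1, -(t * lam * mu * kap / 2 + t ^ 2 * lam * mu / 2); 0, 0, 1] with hM
  have hdet : M.det = 1 := by
    rw [hM, Matrix.det_fin_three]; simp
  have h := map_volume_matrix M (by rw [hdet]; norm_num)
  rw [hdet] at h
  have he : ⇑(flow lam mu kap t) =
      fun x : Conf 3 => WithLp.toLp 2 (M.mulVec (WithLp.ofLp x)) := by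
    funext x
    ext i
    rw [coe_flow]
    fin_cases i <;> simp [flowFun, hM, Matrix.mulVec, dotProduct, Fin.sum_univ_three]; ring
  rw [he, h]
  simp

/-- The vector field generating the flow. -/
def flowGen (lam mu kap : ℝ) (x : Conf 3) : Conf 3 :=
  (mu * x 2) • EuclideanSpace.single 0 1
    + (-(lam * x 0) - lam * mu * kap / 2 * x 2) • EuclideanSpace.single 1 1

theorem hasDerivAt_flow (lam mu kap t : ℝ) (x : Conf 3) :
    HasDerivAt (fun s => flow lam mu kap s x) (flowGen lam mu kap (flow lam mu kap t x)) t := by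
  have he : (fun s => flow lam mu kap s x) = fun s : ℝ => x + s • flowGen lam mu kap x
      + (s ^ 2) • EuclideanSpace.single 1 (-(lam * mu / 2 * x 2)) := by
    funext s
    ext i
    rw [coe_flow]
    fin_cases i <;> simp [flowFun, flowGen] <;> ring
  have hd : flowGen lam mu kap (flow lam mu kap t x) = (1 : ℝ) • flowGen lam mu kap x
      + (2 * t) • (EuclideanSpace.single 1 (-(lam * mu / 2 * x 2)) : Conf 3) := by
    ext i
    rw [coe_flow]
    fin_cases i <;> simp [flowFun, flowGen]; ring
  rw [he, hd]
  refine HasDerivAt.add (HasDerivAt.const_add _ ((hasDerivAt_id t).smul_const _)) ?_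
  simpa using ((hasDerivAt_id t).pow 2).smul_const
    (EuclideanSpace.single 1 (-(lam * mu / 2 * x 2)) : Conf 3)

/-- By homogeneity it suffices to bound the flow on the compact set `[-1, 1] × S²`. Taking the
constant at least `1` lets it also absorb the summand `1` in weights `1 + ‖x‖`. -/
theorem exists_norm_flow_le (lam mu kap : ℝ) :
    ∃ M : ℝ, 1 ≤ M ∧ ∀ t : ℝ, |t| ≤ 1 → ∀ x, ‖flow lam mu kap t x‖ ≤ M * ‖x‖ := by
  have hcont : Continuous fun y : ℝ × Conf 3 => flow lam mu kap y.1 y.2 := by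
    simp only [coe_flow, flowFun]
    refine (PiLp.continuous_toLp 2 _).comp (continuous_pi fun i => ?_)
    fin_cases i <;> simp <;> fun_prop
  have hK : IsCompact (Set.Icc (-1 : ℝ) 1 ×ˢ Metric.sphere (0 : Conf 3) 1) :=
    isCompact_Icc.prod (isCompact_sphere _ _)
  obtain ⟨C, hC⟩ := hK.exists_bound_of_continuousOn hcont.continuousOn
  refine ⟨max C 1, le_max_right _ _, fun t ht x => ?_⟩
  by_cases hx : x = 0
  · simp [hx]
  have hx' : 0 < ‖x‖ := norm_pos_iff.2 hx
  have h := hC (t, ‖x‖⁻¹ • x) ⟨abs_le.1 ht, by simp [norm_smul, hx'.ne']⟩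
  simp only [map_smul, norm_smul, norm_inv, norm_norm] at h
  rw [inv_mul_le_iff₀ hx'] at h
  calc _ ≤ ‖x‖ * C := h
    _ ≤ _ := by rw [mul_comm]; gcongr; exact le_max_left _ _

/-! ### The Hamiltonian as a first-order differential operator. -/

theorem momOp_apply {n : ℕ} (j : Fin n) (f : 𝓢(Conf n, ℂ)) (x : Conf n) :
    momOp j f x = -Complex.I * fderiv ℝ f x (EuclideanSpace.single j 1) := by
  simp [momOp, SchwartzMap.lineDerivOp_apply_eq_fderiv]

theorem fderiv_posOp_of_ne {n : ℕ} {i j : Fin n} (hij : i ≠ j) (f : 𝓢(Conf n, ℂ)) (x : Conf n) :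
    fderiv ℝ (posOp j f) x (EuclideanSpace.single i 1)
      = (x j : ℂ) * fderiv ℝ f x (EuclideanSpace.single i 1) := by
  have he : ⇑(posOp j f) = fun y : Conf n => ((y j : ℝ) : ℂ) * f y := by
    funext y; exact posOp_apply j f y
  let L : Conf n →L[ℝ] ℂ := Complex.ofRealCLM.comp (EuclideanSpace.proj j : Conf n →L[ℝ] ℝ)
  have hL : HasFDerivAt (fun y : Conf n => ((y j : ℝ) : ℂ)) L x := L.hasFDerivAt
  have h := hL.mul f.differentiableAt.hasFDerivAt
  rw [he, show (fun y : Conf n => ((y j : ℝ) : ℂ) * f y) = (fun y : Conf n => ((y j : ℝ) : ℂ)) * ⇑f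
    from rfl, h.fderiv]
  simp [L, Ne.symm hij]

/-- In each term of `H` the position and the momentum belong to different coordinates and commute,
so no zeroth-order term survives; `(-i)(-i) = -1` makes the coefficients real. Hence `-iH` is the
derivative along `flowGen`. -/
theorem neg_I_smul_hamiltonian_apply (lam mu kap : ℝ) (f : 𝓢(Conf 3, ℂ)) (x : Conf 3) :
    ((-Complex.I) • hamiltonian lam mu kap f) x = fderiv ℝ f x (flowGen lam mu kap x) := by
  simp only [hamiltonian, flowGen, map_add, map_smul, smul_apply, add_apply, sub_apply,
    ContinuousLinearMap.comp_apply, posOp_apply,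
    momOp_apply, fderiv_posOp_of_ne (show (0 : Fin 3) ≠ 2 by decide),
    fderiv_posOp_of_ne (show (1 : Fin 3) ≠ 2 by decide), smul_eq_mul, Complex.real_smul]
  push_cast
  linear_combination (-(lam : ℂ) * x 0 * fderiv ℝ f x (EuclideanSpace.single 1 1) * (-1)
    - mu * x 2 * fderiv ℝ f x (EuclideanSpace.single 0 1)
    + (lam * mu / 2 * kap) * x 2 * fderiv ℝ f x (EuclideanSpace.single 1 1)) * Complex.I_sq

theorem hasDerivAt_comp_flow (lam mu kap t : ℝ) (f : 𝓢(Conf 3, ℂ)) (x : Conf 3) :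
    HasDerivAt (fun s => f (flow lam mu kap s x))
      (((-Complex.I) • hamiltonian lam mu kap f) (flow lam mu kap t x)) t := by
  rw [neg_I_smul_hamiltonian_apply]
  exact f.differentiableAt.hasFDerivAt.comp_hasDerivAt t (hasDerivAt_flow lam mu kap t x)

/-- Schwartz decay survives the flow uniformly for bounded times. The exponent `4` suffices because
its double `8` exceeds the dimension `3`, so the bound is square-integrable. -/
theorem exists_norm_comp_flow_le (lam mu kap : ℝ) (g : 𝓢(Conf 3, ℂ)) :
    ∃ C : ℝ, ∀ t : ℝ, |t| ≤ 1 → ∀ x,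
      ‖g (flow lam mu kap t x)‖ ≤ C * (1 + ‖x‖) ^ (-4 : ℝ) := by
  obtain ⟨M, hM1, hM⟩ := exists_norm_flow_le lam mu kap
  have hg : ∃ C : ℝ, ∀ y, (1 + ‖y‖) ^ 4 * ‖g y‖ ≤ C := by
    refine ⟨2 ^ 4 * ((Finset.Iic ((4, 0) : ℕ × ℕ)).sup
      fun m => SchwartzMap.seminorm ℝ m.1 m.2) g, fun y => ?_⟩
    simpa using SchwartzMap.one_add_le_sup_seminorm_apply (𝕜 := ℝ) (m := (4, 0)) le_rfl le_rfl g y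
  obtain ⟨C, hC⟩ := hg
  refine ⟨M ^ 4 * C, fun t ht x => ?_⟩
  -- The lower bound on the flow is the upper bound for the reversed time `-t`.
  have h1 : ‖x‖ ≤ M * ‖flow lam mu kap t x‖ := by
    have := hM (-t) (by simpa using ht) (flow lam mu kap t x)
    rwa [coe_flow, coe_flow, flowFun_flowFun, neg_add_cancel, flowFun_zero] at this
  have h2 : 1 + ‖x‖ ≤ M * (1 + ‖flow lam mu kap t x‖) := by linarith
  have h3 : (1 + ‖x‖) ^ 4 * ‖g (flow lam mu kap t x)‖ ≤ M ^ 4 * C := by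
    calc _ ≤ (M * (1 + ‖flow lam mu kap t x‖)) ^ 4 * ‖g (flow lam mu kap t x)‖ := by gcongr
      _ = M ^ 4 * ((1 + ‖flow lam mu kap t x‖) ^ 4 * ‖g (flow lam mu kap t x)‖) := by ring
      _ ≤ _ := by gcongr; exact hC _
  have hpos : (0 : ℝ) < (1 + ‖x‖) ^ 4 := by positivity
  rw [Real.rpow_neg (by positivity), ← div_eq_mul_inv, le_div_iff₀ (by positivity), mul_comm]
  exact_mod_cast h3

theorem memLp_two_one_add_norm_rpow :
    MemLp (fun x : Conf 3 => (1 + ‖x‖) ^ (-4 : ℝ)) 2 volume := by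
  have hc : Continuous fun x : Conf 3 => (1 + ‖x‖) ^ (-4 : ℝ) :=
    Continuous.rpow_const (by fun_prop) fun x => Or.inl (by positivity)
  rw [memLp_two_iff_integrable_sq hc.aestronglyMeasurable]
  have h := integrable_one_add_norm (E := Conf 3) (μ := volume) (r := 8) (by simp; norm_num)
  refine h.congr (Filter.Eventually.of_forall fun x => ?_)
  simp only
  rw [← Real.rpow_natCast, ← Real.rpow_mul (by positivity)]
  norm_num

/-! ### The unitary group of the flow and its generator. -/

theorem unitary_mul_apply {H : Type*} [NormedAddCommGroup H] [InnerProductSpace ℂ H]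
    (A B : H ≃ₗᵢ[ℂ] H) (ψ : H) : (A * B) ψ = A (B ψ) := rfl

/-- The one-parameter unitary group `ψ ↦ ψ ∘ flow t`. -/
def flowUnitary (lam mu kap t : ℝ) : L2 (Conf 3) ≃ₗᵢ[ℂ] L2 (Conf 3) :=
  { (Lp.compMeasurePreservingₗᵢ ℂ _ (measurePreserving_flow lam mu kap t)) with
    invFun := Lp.compMeasurePreserving _ (measurePreserving_flow lam mu kap (-t))
    left_inv := fun ψ => by
      change Lp.compMeasurePreserving _ (measurePreserving_flow lam mu kap (-t))
        (Lp.compMeasurePreserving _ (measurePreserving_flow lam mu kap t) ψ) = ψ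
      rw [← Lp.compMeasurePreserving_comp_apply]
      convert Lp.compMeasurePreserving_id_apply ψ
      funext x
      simp [coe_flow, flowFun_flowFun, flowFun_zero]
    right_inv := fun ψ => by
      change Lp.compMeasurePreserving _ (measurePreserving_flow lam mu kap t)
        (Lp.compMeasurePreserving _ (measurePreserving_flow lam mu kap (-t)) ψ) = ψ
      rw [← Lp.compMeasurePreserving_comp_apply]
      convert Lp.compMeasurePreserving_id_apply ψ
      funext x
      simp [coe_flow, flowFun_flowFun, flowFun_zero] }

theorem flowUnitary_apply (lam mu kap t : ℝ) (ψ : L2 (Conf 3)) :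
    flowUnitary lam mu kap t ψ
      = Lp.compMeasurePreserving _ (measurePreserving_flow lam mu kap t) ψ := rfl

theorem flowUnitary_add (lam mu kap s t : ℝ) :
    flowUnitary lam mu kap (s + t) = flowUnitary lam mu kap s * flowUnitary lam mu kap t := by
  ext1 ψ
  rw [unitary_mul_apply, flowUnitary_apply, flowUnitary_apply, flowUnitary_apply,
    ← Lp.compMeasurePreserving_comp_apply]
  congr 2
  funext x
  simp [coe_flow, flowFun_flowFun, add_comm]

theorem continuous_flowUnitary (lam mu kap : ℝ) (ψ : L2 (Conf 3)) :
    Continuous fun t => flowUnitary lam mu kap t ψ := by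
  have hcont : Continuous fun y : ℝ × Conf 3 => flow lam mu kap y.1 y.2 := by
    simp only [coe_flow, flowFun]
    refine (PiLp.continuous_toLp 2 _).comp (continuous_pi fun i => ?_)
    fin_cases i <;> simp <;> fun_prop
  let g : C(ℝ, C(Conf 3, Conf 3)) := ContinuousMap.curry ⟨_, hcont⟩
  exact Continuous.compMeasurePreservingLp (f := fun _ : ℝ => ψ) (g := g) continuous_const
    g.continuous (fun t => measurePreserving_flow lam mu kap t) ENNReal.ofNat_ne_top

/-- The action of the flow on Schwartz functions. -/
def flowSchwartz (lam mu kap t : ℝ) (f : 𝓢(Conf 3, ℂ)) : 𝓢(Conf 3, ℂ) :=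
  SchwartzMap.compCLMOfContinuousLinearEquiv ℂ (flow lam mu kap t) f

theorem flowUnitary_toLp (lam mu kap t : ℝ) (f : 𝓢(Conf 3, ℂ)) :
    flowUnitary lam mu kap t (f.toLp 2 volume) = (flowSchwartz lam mu kap t f).toLp 2 volume := rfl

/-- Along a flow line the derivative of `f` is `-iHf` evaluated on that line. The mean value
inequality turns the uniform decay of `-iHf` into the domination needed for differentiation in `L²`.
-/
theorem hasDerivAt_flowUnitary_toLp (lam mu kap : ℝ) (f : 𝓢(Conf 3, ℂ)) :
    HasDerivAt (fun t => flowUnitary lam mu kap t (f.toLp 2 volume))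
      ((-Complex.I) • (hamiltonian lam mu kap f).toLp 2 volume) 0 := by
  set K : 𝓢(Conf 3, ℂ) := (-Complex.I) • hamiltonian lam mu kap f with hK
  obtain ⟨C, hC⟩ := exists_norm_comp_flow_le lam mu kap K
  have h := hasDerivAt_toLp_two_of_dominated
    (F := fun t x => f (flow lam mu kap t x)) (G := K) (μ := volume)
    (fun t => (flowSchwartz lam mu kap t f).memLp 2 volume) (K.memLp 2 volume)
    (memLp_two_one_add_norm_rpow.const_mul C) ?_ ?_
  · exact h
  · intro t ht x
    have h1 := Convex.norm_image_sub_le_of_norm_hasDerivWithin_le (𝕜 := ℝ) (s := Set.Icc (-1) 1)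
      (f := fun s => f (flow lam mu kap s x)) (f' := fun s => K (flow lam mu kap s x))
      (x := 0) (y := t) (fun s _ => (hasDerivAt_comp_flow lam mu kap s f x).hasDerivWithinAt)
      (fun s hs => hC s (abs_le.2 hs) x) (convex_Icc _ _) (by simp) (abs_le.1 ht)
    simpa [mul_comm] using h1
  · intro x
    have h1 := hasDerivAt_comp_flow lam mu kap 0 f x
    rwa [coe_flow lam mu kap 0, flowFun_zero] at h1

theorem isExpNegI_flowUnitary (lam mu kap : ℝ) :
    IsExpNegI (hamiltonian lam mu kap) (flowUnitary lam mu kap 1) :=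
  ⟨flowUnitary lam mu kap, flowUnitary_add lam mu kap, continuous_flowUnitary lam mu kap,
    hasDerivAt_flowUnitary_toLp lam mu kap, rfl⟩

/-! ### Uniqueness of the exponential and identification of `coupling`. -/

/-- A one-parameter unitary group is determined by its generator on Schwartz functions, if these are
invariant under the group. -/
theorem unitaryGroup_unique {n : ℕ} {H : 𝓢(Conf n, ℂ) →L[ℂ] 𝓢(Conf n, ℂ)}
    {V W : ℝ → (L2 (Conf n) ≃ₗᵢ[ℂ] L2 (Conf n))}
    (hV : ∀ s t, V (s + t) = V s * V t) (hW : ∀ s t, W (s + t) = W s * W t)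
    (hVd : ∀ f : 𝓢(Conf n, ℂ), HasDerivAt (fun t => V t (f.toLp 2 volume))
      ((-Complex.I) • (H f).toLp 2 volume) 0)
    (hWd : ∀ f : 𝓢(Conf n, ℂ), HasDerivAt (fun t => W t (f.toLp 2 volume))
      ((-Complex.I) • (H f).toLp 2 volume) 0)
    (hinv : ∀ t (f : 𝓢(Conf n, ℂ)), ∃ g : 𝓢(Conf n, ℂ),
      V t (f.toLp 2 volume) = g.toLp 2 volume) (t : ℝ) : V t = W t := by
  have hV0 : V 0 = 1 := by simpa using hV 0 0
  have hW0 : W 0 = 1 := by simpa using hW 0 0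
  have hWinv : ∀ t ψ, W t (W (-t) ψ) = ψ := fun t ψ => by
    rw [← unitary_mul_apply, ← hW, add_neg_cancel, hW0]; rfl
  -- Applying the isometry `W h` shows that the increment `W (-h) V(h) f - f` has the norm of `V(h)
  -- f - W(h) f`, which is `o(h)` because both curves have the same derivative at `0`.
  have key : ∀ f : 𝓢(Conf n, ℂ), HasDerivAt (fun h => W (-h) (V h (f.toLp 2 volume))) 0 0 := by
    intro f
    have h1 := (hVd f).sub (hWd f)
    rw [sub_self, hasDerivAt_iff_tendsto] at h1
    rw [hasDerivAt_iff_tendsto]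
    refine h1.congr fun h => ?_
    congr 1
    simp only [Pi.sub_apply, hV0, hW0, smul_zero, sub_zero, LinearIsometryEquiv.coe_one, id_eq,
      sub_self, neg_zero]
    rw [← (W h).norm_map (W (-h) _ - _), map_sub, hWinv]
  have hconst : ∀ f : 𝓢(Conf n, ℂ), ∀ t, W (-t) (V t (f.toLp 2 volume)) = f.toLp 2 volume := by
    intro f t
    have hd : ∀ s, HasDerivAt (fun h => W (-h) (V h (f.toLp 2 volume))) 0 s := by
      intro s
      -- Invariance enters here: `V s f` is again a Schwartz function `g`, and the group laws reduce
      -- the derivative at time `s` for `f` to the derivative at time `0` for `g`.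
      obtain ⟨g, hg⟩ := hinv s f
      have h1 : HasDerivAt (fun h => W (-s) (W (-h) (V h (g.toLp 2 volume)))) 0 0 := by
        have := ((W (-s)).toContinuousLinearEquiv.toContinuousLinearMap.restrictScalars
          ℝ).hasFDerivAt.comp_hasDerivAt 0 (key g)
        rw [map_zero] at this
        exact this
      have h2 : HasDerivAt (fun h => W (-s) (W (-(h - s)) (V (h - s) (g.toLp 2 volume)))) 0 s := by
        have h3 : HasDerivAt (fun h => W (-s) (W (-h) (V h (g.toLp 2 volume)))) 0 (s - s) := by
          rwa [sub_self]
        exact h3.comp_sub_const s s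
      refine h2.congr_of_eventuallyEq (Filter.Eventually.of_forall fun h => ?_)
      simp only
      rw [← hg, ← unitary_mul_apply (V _), ← hV, sub_add_cancel, ← unitary_mul_apply (W _) (W _),
        ← hW, show -s + -(h - s) = -h by ring]
    have := is_const_of_deriv_eq_zero (fun s => (hd s).differentiableAt)
      (fun s => (hd s).deriv) t 0
    simpa [hV0, hW0] using this
  have hdense := SchwartzMap.denseRange_toLpCLM (E := Conf n) (F := ℂ) (p := 2)
    (μ := volume) ENNReal.ofNat_ne_top
  ext1 ψ
  refine hdense.induction_on (p := fun ψ => V t ψ = W t ψ) ψ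
    (isClosed_eq (V t).continuous (W t).continuous) fun f => ?_
  change V t (f.toLp 2 volume) = W t (f.toLp 2 volume)
  calc V t (f.toLp 2 volume) = W t (W (-t) (V t (f.toLp 2 volume))) := (hWinv _ _).symm
    _ = _ := by rw [hconst]

theorem isExpNegI_hamiltonian_iff (lam mu kap : ℝ) (U : L2 (Conf 3) ≃ₗᵢ[ℂ] L2 (Conf 3)) :
    IsExpNegI (hamiltonian lam mu kap) U ↔ U = flowUnitary lam mu kap 1 := by
  constructor
  · rintro ⟨W, hW, -, hWd, rfl⟩
    exact (unitaryGroup_unique (flowUnitary_add lam mu kap) hW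
      (hasDerivAt_flowUnitary_toLp lam mu kap) hWd
      (fun t f => ⟨_, flowUnitary_toLp lam mu kap t f⟩) 1).symm
  · rintro rfl
    exact isExpNegI_flowUnitary lam mu kap

theorem existsUnique_isExpNegI_hamiltonian (lam mu kap : ℝ) :
    ∃! U, IsExpNegI (hamiltonian lam mu kap) U :=
  ⟨_, isExpNegI_flowUnitary lam mu kap, fun _ h => (isExpNegI_hamiltonian_iff lam mu kap _).1 h⟩

/-- Existence and uniqueness replace the arbitrary choice in `coupling` by a concrete substitution.
-/
theorem coupling_eq_flowUnitary (lam mu kap : ℝ) :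
    coupling lam mu kap = flowUnitary lam mu kap 1 :=
  (isExpNegI_hamiltonian_iff lam mu kap _).1
    (Classical.epsilon_spec ⟨_, isExpNegI_flowUnitary lam mu kap⟩)

/-! ### The Fourier transform on `L²` -/

section Fourier

variable {E : Type*} [NormedAddCommGroup E] [InnerProductSpace ℝ E] [FiniteDimensional ℝ E]
  [MeasurableSpace E] [BorelSpace E]

/-- On `L¹ ∩ L²` the Plancherel transform is given by the Fourier integral. -/
theorem fourierTransform_toLp_ae_eq {f : E → ℂ} (h1 : Integrable f) (h2 : MemLp f 2 volume) :
    (Lp.fourierTransformₗᵢ E ℂ (h2.toLp f) : L2 E) =ᵐ[volume] 𝓕 f := by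
  have hcont : Continuous (𝓕 f : E → ℂ) :=
    VectorFourier.fourierIntegral_continuous Real.continuous_fourierChar
      (by exact continuous_inner) h1
  -- Both sides are compared by integrating against smooth compactly supported functions. The
  -- transform moves onto the test function, for the `L²` transform by its distributional definition
  -- and for the integral by Fubini.
  refine ae_eq_of_integral_contDiff_smul_eq
    ((Lp.memLp _).locallyIntegrable (by norm_num)) hcont.locallyIntegrable fun g hg hgc => ?_
  have hg₁ : HasCompactSupport (Complex.ofRealCLM ∘ g) := hgc.comp_left rfl
  have hg₂ : ContDiff ℝ (⊤ : ℕ∞) (Complex.ofRealCLM ∘ g) := Complex.ofRealCLM.contDiff.comp hg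
  set G : 𝓢(E, ℂ) := hg₁.toSchwartzMap hg₂ with hG
  have hGx : ∀ x, G x = (g x : ℂ) := fun x => rfl
  have h := DFunLike.congr_fun (Lp.fourier_toTemperedDistribution_eq (h2.toLp f)) G
  rw [TemperedDistribution.fourier_apply, Lp.toTemperedDistribution_apply,
    Lp.toTemperedDistribution_apply] at h
  have hself : ∫ ξ, (𝓕 (G : E → ℂ) ξ) • f ξ = ∫ x, G x • 𝓕 f x := by
    have h3 := VectorFourier.integral_fourierIntegral_smul_eq_flip (L := innerₗ E)
      Real.continuous_fourierChar (by exact continuous_inner) (G.integrable (μ := volume)) h1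
    rw [flip_innerₗ] at h3
    exact h3
  calc ∫ x, g x • (Lp.fourierTransformₗᵢ E ℂ (h2.toLp f) : L2 E) x
      = ∫ x, G x • (𝓕 (h2.toLp f) : L2 E) x := by
        refine integral_congr_ae (Filter.Eventually.of_forall fun x => ?_)
        simp only [hGx, Complex.real_smul, smul_eq_mul]
        rfl
    _ = ∫ x, (𝓕 G) x • (h2.toLp f : L2 E) x := h.symm
    _ = ∫ x, (𝓕 (G : E → ℂ)) x • f x := by
        refine integral_congr_ae ?_
        filter_upwards [h2.coeFn_toLp] with x hx
        rw [hx, SchwartzMap.fourier_coe]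
    _ = ∫ x, G x • 𝓕 f x := hself
    _ = _ := by simp only [hGx, Complex.real_smul, smul_eq_mul]

theorem fourier_comp_of_inner_eq {B C : E → E} (hB : MeasurePreserving B volume volume)
    (hBe : MeasurableEmbedding B) (hBC : ∀ x ξ, inner ℝ (B x) (C ξ) = inner ℝ x ξ)
    (f : E → ℂ) (ξ : E) : 𝓕 (f ∘ B) ξ = 𝓕 f (C ξ) := by
  rw [Real.fourier_eq, Real.fourier_eq,
    ← hB.integral_comp hBe fun v => 𝐞 (-inner ℝ v (C ξ)) • f v]
  simp only [hBC, Function.comp]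

/-- The Fourier transform intertwines a linear substitution and its contragredient. -/
theorem fourierTransform_compMeasurePreserving {B C : E → E}
    (hB : MeasurePreserving B volume volume) (hBe : MeasurableEmbedding B)
    (hC : MeasurePreserving C volume volume) (hBC : ∀ x ξ, inner ℝ (B x) (C ξ) = inner ℝ x ξ)
    (φ : L2 E) :
    Lp.fourierTransformₗᵢ E ℂ (Lp.compMeasurePreserving B hB φ)
      = Lp.compMeasurePreserving C hC (Lp.fourierTransformₗᵢ E ℂ φ) := by
  have hdense := SchwartzMap.denseRange_toLpCLM (E := E) (F := ℂ) (p := 2)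
    (μ := volume) ENNReal.ofNat_ne_top
  refine hdense.induction_on (p := fun φ => Lp.fourierTransformₗᵢ E ℂ
    (Lp.compMeasurePreserving B hB φ)
      = Lp.compMeasurePreserving C hC (Lp.fourierTransformₗᵢ E ℂ φ)) φ
    (isClosed_eq ?_ ?_) fun f => ?_
  · exact (Lp.fourierTransformₗᵢ E ℂ).continuous.comp
      (Lp.isometry_compMeasurePreserving hB).continuous
  · exact (Lp.isometry_compMeasurePreserving hC).continuous.comp
      (Lp.fourierTransformₗᵢ E ℂ).continuous
  · change Lp.fourierTransformₗᵢ E ℂ (Lp.compMeasurePreserving B hB (f.toLp 2 volume))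
      = Lp.compMeasurePreserving C hC (𝓕 (f.toLp 2 volume))
    rw [SchwartzMap.toLp_fourier_eq]
    -- For a general `B` the function `f ∘ B` need not be Schwartz, but it lies in `L¹ ∩ L²`, so its
    -- Plancherel transform is still given by the Fourier integral.
    change Lp.fourierTransformₗᵢ E ℂ (((f.memLp 2 volume).comp_measurePreserving hB).toLp _) = _
    refine Lp.ext ?_
    have h1 := fourierTransform_toLp_ae_eq (hB.integrable_comp_of_integrable f.integrable)
      ((f.memLp 2 volume).comp_measurePreserving hB)
    have h2 := Lp.coeFn_compMeasurePreserving ((𝓕 f).toLp 2 volume) hC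
    have h3 := hC.quasiMeasurePreserving.ae ((𝓕 f).coeFn_toLp 2 volume)
    filter_upwards [h1, h2, h3] with ξ e1 e2 e3
    rw [e1, e2, Function.comp_apply, e3, fourier_comp_of_inner_eq hB hBe hBC,
      SchwartzMap.fourier_coe]

end Fourier

/-! ### Fourier transform of tensor products -/

theorem split_apply (x : Conf 3) : split x = (x 0, !₂[x 1, x 2]) := rfl

theorem ae_comp_snd {p : Conf 2 → Prop} (h : ∀ᵐ y, p y) : ∀ᵐ x : Conf 3, p !₂[x 1, x 2] :=
  (Measure.quasiMeasurePreserving_snd.comp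
    measurePreserving_split.quasiMeasurePreserving).ae h

theorem coeFn_tensor (ψ : L2 ℝ) (φ : L2 (Conf 2)) :
    tensor ψ φ =ᵐ[volume] fun x : Conf 3 => ψ (x 0) * φ !₂[x 1, x 2] :=
  (memLp_tensor ψ φ).coeFn_toLp

theorem norm_tensor (ψ : L2 ℝ) (φ : L2 (Conf 2)) : ‖tensor ψ φ‖ = ‖ψ‖ * ‖φ‖ := by
  rw [tensor, Lp.norm_toLp, eLpNorm_tensor, ENNReal.toReal_mul, Lp.norm_def, Lp.norm_def]

theorem tensor_sub_right (ψ : L2 ℝ) (φ χ : L2 (Conf 2)) :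
    tensor ψ (φ - χ) = tensor ψ φ - tensor ψ χ := by
  unfold tensor
  rw [← MemLp.toLp_sub]
  refine MemLp.toLp_congr _ _ ?_
  filter_upwards [ae_comp_snd (Lp.coeFn_sub φ χ)] with x hx
  rw [hx]; exact mul_sub _ _ _

theorem continuous_tensor_right (ψ : L2 ℝ) : Continuous fun φ : L2 (Conf 2) => tensor ψ φ := by
  refine (LipschitzWith.of_dist_le_mul (K := ‖ψ‖₊) fun φ χ => ?_).continuous
  rw [dist_eq_norm, dist_eq_norm, ← tensor_sub_right, norm_tensor, coe_nnnorm]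

theorem continuous_tensor_left (φ : L2 (Conf 2)) : Continuous fun ψ : L2 ℝ => tensor ψ φ :=
  (tensorL φ).continuous

theorem inner_conf_three (x ξ : Conf 3) :
    inner ℝ x ξ = inner ℝ (x 0) (ξ 0) + inner ℝ (!₂[x 1, x 2] : Conf 2) !₂[ξ 1, ξ 2] := by
  simp [PiLp.inner_apply, Fin.sum_univ_three, Fin.sum_univ_two, add_assoc]

theorem fourier_tensor_fun {f : ℝ → ℂ} {g : Conf 2 → ℂ} (hf : Integrable f) (hg : Integrable g)
    (ξ : Conf 3) :
    𝓕 (fun x : Conf 3 => f (x 0) * g !₂[x 1, x 2]) ξ = 𝓕 f (ξ 0) * 𝓕 g !₂[ξ 1, ξ 2] := by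
  have hf' := (Real.fourierIntegral_convergent_iff (μ := volume) (f := f) (ξ 0)).2 hf
  have hg' := (Real.fourierIntegral_convergent_iff (μ := volume) (f := g) !₂[ξ 1, ξ 2]).2 hg
  rw [Real.fourier_eq, Real.fourier_eq, Real.fourier_eq, ← integral_prod_mul]
  have hm := (hf'.mul_prod hg').aestronglyMeasurable
  have hs := measurePreserving_split.map_eq
  rw [Measure.volume_eq_prod] at hs
  rw [← hs] at hm ⊢
  rw [integral_map measurePreserving_split.aemeasurable hm]
  refine integral_congr_ae (Filter.Eventually.of_forall fun x => ?_)
  simp only [split_apply, inner_conf_three, neg_add, AddChar.map_add_eq_mul, Circle.smul_def,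
    Circle.coe_mul, smul_eq_mul]
  ring

/-- Both sides are continuous in each factor separately, so density reduces the claim to Schwartz
factors, where the Fourier integral factorizes by Fubini. -/
theorem fourier_tensor (ψ : L2 ℝ) (φ : L2 (Conf 2)) :
    fourierL2 3 (tensor ψ φ) = tensor (Lp.fourierTransformₗᵢ ℝ ℂ ψ) (fourierL2 2 φ) := by
  have hd1 := SchwartzMap.denseRange_toLpCLM (E := ℝ) (F := ℂ) (p := 2)
    (μ := volume) ENNReal.ofNat_ne_top
  have hd2 := SchwartzMap.denseRange_toLpCLM (E := Conf 2) (F := ℂ) (p := 2)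
    (μ := volume) ENNReal.ofNat_ne_top
  refine hd1.induction_on (p := fun ψ => fourierL2 3 (tensor ψ φ)
      = tensor (Lp.fourierTransformₗᵢ ℝ ℂ ψ) (fourierL2 2 φ)) ψ (isClosed_eq ?_ ?_) fun f => ?_
  · exact (fourierL2 3).continuous.comp (continuous_tensor_left φ)
  · exact (continuous_tensor_left _).comp (Lp.fourierTransformₗᵢ ℝ ℂ).continuous
  refine hd2.induction_on (p := fun φ => fourierL2 3 (tensor (f.toLp 2 volume) φ)
      = tensor (Lp.fourierTransformₗᵢ ℝ ℂ (f.toLp 2 volume)) (fourierL2 2 φ)) φ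
      (isClosed_eq ?_ ?_) fun g => ?_
  · exact (fourierL2 3).continuous.comp (continuous_tensor_right _)
  · exact (continuous_tensor_right _).comp (fourierL2 2).continuous
  change fourierL2 3 (tensor (f.toLp 2 volume) (g.toLp 2 volume))
    = tensor (𝓕 (f.toLp 2 volume)) (𝓕 (g.toLp 2 volume))
  rw [SchwartzMap.toLp_fourier_eq, SchwartzMap.toLp_fourier_eq]
  have hae : (fun x : Conf 3 => (f.toLp 2 volume : L2 ℝ) (x 0)
      * (g.toLp 2 volume : L2 (Conf 2)) !₂[x 1, x 2])
      =ᵐ[volume] fun x : Conf 3 => f (x 0) * g !₂[x 1, x 2] := by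
    filter_upwards [ae_comp_fst (f.coeFn_toLp 2 volume), ae_comp_snd (g.coeFn_toLp 2 volume)]
      with x h1 h2
    rw [h1, h2]
  have hmem : MemLp (fun x : Conf 3 => f (x 0) * g !₂[x 1, x 2]) 2 volume :=
    (memLp_congr_ae hae).1 (memLp_tensor _ _)
  have hint : Integrable (fun x : Conf 3 => f (x 0) * g !₂[x 1, x 2]) :=
    measurePreserving_split.integrable_comp_of_integrable (f.integrable.mul_prod g.integrable)
  have ht : tensor (f.toLp 2 volume) (g.toLp 2 volume) = hmem.toLp _ :=
    MemLp.toLp_congr _ _ hae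
  rw [ht]
  refine Lp.ext ?_
  have h1 := fourierTransform_toLp_ae_eq hint hmem
  filter_upwards [h1, coeFn_tensor ((𝓕 f).toLp 2 volume) ((𝓕 g).toLp 2 volume),
    ae_comp_fst ((𝓕 f).coeFn_toLp 2 volume), ae_comp_snd ((𝓕 g).coeFn_toLp 2 volume)]
    with ξ e1 e2 e3 e4
  rw [e2, e3, e4, SchwartzMap.fourier_coe, SchwartzMap.fourier_coe,
    ← fourier_tensor_fun f.integrable g.integrable]
  exact e1

/-! ### The coupling in momentum space -/

/-- The contragredient of the time-one flow. -/
def dualFlow (lam mu kap : ℝ) (ξ : Conf 3) : Conf 3 :=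
  !₂[ξ 0 + lam * ξ 1, ξ 1, ξ 2 - mu * ξ 0 + lam * mu / 2 * (kap - 1) * ξ 1]

/-- This duality characterizes `dualFlow` as the inverse transpose of the time-one flow; it is the
condition under which the Fourier transform intertwines the two substitutions. -/
theorem inner_flow_dualFlow (lam mu kap : ℝ) (x ξ : Conf 3) :
    inner ℝ (flow lam mu kap 1 x) (dualFlow lam mu kap ξ) = inner ℝ x ξ := by
  rw [coe_flow]
  simp [PiLp.inner_apply, Fin.sum_univ_three, flowFun, dualFlow]
  ring

theorem measurePreserving_dualFlow (lam mu kap : ℝ) :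
    MeasurePreserving (dualFlow lam mu kap) volume volume := by
  set M : Matrix (Fin 3) (Fin 3) ℝ := !![1, lam, 0; 0, 1, 0;
    -mu, lam * mu / 2 * (kap - 1), 1] with hM
  have hdet : M.det = 1 := by
    rw [hM, Matrix.det_fin_three]; simp
  have h := map_volume_matrix M (by rw [hdet]; norm_num)
  rw [hdet] at h
  have he : dualFlow lam mu kap =
      fun x : Conf 3 => WithLp.toLp 2 (M.mulVec (WithLp.ofLp x)) := by
    funext x
    ext i
    fin_cases i <;> simp [dualFlow, hM, Matrix.mulVec, dotProduct, Fin.sum_univ_three]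
    ring
  refine ⟨?_, by rw [he, h]; simp⟩
  have hc : Continuous (dualFlow lam mu kap) := by
    unfold dualFlow
    refine (PiLp.continuous_toLp 2 _).comp (continuous_pi fun i => ?_)
    fin_cases i <;> simp <;> fun_prop
  exact hc.measurable

theorem fourier_flowUnitary (lam mu kap : ℝ) (Ψ : L2 (Conf 3)) :
    fourierL2 3 (flowUnitary lam mu kap 1 Ψ) =
      Lp.compMeasurePreserving _ (measurePreserving_dualFlow lam mu kap) (fourierL2 3 Ψ) :=
  fourierTransform_compMeasurePreserving (measurePreserving_flow lam mu kap 1)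
    (flow lam mu kap 1).toHomeomorph.measurableEmbedding (measurePreserving_dualFlow lam mu kap)
    (inner_flow_dualFlow lam mu kap) Ψ

/-! ### Position and momentum laws -/

theorem map_withDensity_comp {α β : Type*} [MeasurableSpace α] [MeasurableSpace β]
    {μ : Measure α} {f : α → β} (hf : Measurable f) {g : β → ℝ≥0∞} (hg : Measurable g) :
    (μ.withDensity fun x => g (f x)).map f = (μ.map f).withDensity g := by
  ext s hs
  rw [Measure.map_apply hf hs, withDensity_apply _ (hf hs), withDensity_apply _ hs,
    setLIntegral_map hs hg hf]

section Law

variable {E : Type*} [NormedAddCommGroup E] [InnerProductSpace ℝ E] [FiniteDimensional ℝ E]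
  [MeasurableSpace E] [BorelSpace E]

theorem measurable_coeFn (φ : L2 E) : Measurable (φ : E → ℂ) :=
  (Lp.stronglyMeasurable φ).measurable

theorem measurable_momWave (φ : L2 E) : Measurable (momWave φ) := by
  unfold momWave
  exact ((measurable_coeFn _).comp (measurable_const_smul _)).const_mul _

theorem posLaw_univ (φ : L2 E) : posLaw φ Set.univ = ENNReal.ofReal (‖φ‖ ^ 2) := by
  rw [posLaw, withDensity_apply _ MeasurableSet.univ, Measure.restrict_univ,
    ENNReal.ofReal_pow (norm_nonneg _), ofReal_norm, Lp.enorm_def,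
    eLpNorm_eq_lintegral_rpow_enorm_toReal two_ne_zero ENNReal.ofNat_ne_top,
    ← ENNReal.rpow_natCast, ← ENNReal.rpow_mul]
  simp

instance isFiniteMeasure_posLaw (φ : L2 E) : IsFiniteMeasure (posLaw φ) :=
  ⟨by rw [posLaw_univ]; exact ENNReal.ofReal_lt_top⟩

theorem isProbabilityMeasure_posLaw {φ : L2 E} (h : ‖φ‖ = 1) :
    IsProbabilityMeasure (posLaw φ) :=
  ⟨by rw [posLaw_univ, h]; simp⟩

/-- The momentum law is the position law of the Fourier transform, rescaled by `2π`. -/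
theorem momLaw_eq_map (φ : L2 E) :
    momLaw φ = (posLaw (Lp.fourierTransformₗᵢ E ℂ φ)).map fun ξ => (2 * Real.pi) • ξ := by
  have hpi : (0 : ℝ) < 2 * Real.pi := by positivity
  set F : L2 E := Lp.fourierTransformₗᵢ E ℂ φ with hF
  set d := Module.finrank ℝ E
  have hg : Measurable fun p : E => ‖F ((2 * Real.pi)⁻¹ • p)‖ₑ ^ 2 :=
    ((measurable_coeFn F).comp (measurable_const_smul _)).enorm.pow_const 2
  have h1 := map_withDensity_comp (μ := (volume : Measure E)) (f := fun ξ => (2 * Real.pi) • ξ)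
    (measurable_const_smul _) hg
  simp only [inv_smul_smul₀ hpi.ne'] at h1
  rw [posLaw, h1, Measure.map_addHaar_smul _ hpi.ne', momLaw, withDensity_smul_measure,
    ← withDensity_smul _ hg]
  congr 1
  funext p
  simp only [momWave, Pi.smul_apply, smul_eq_mul, enorm_mul, mul_pow]
  congr 1
  rw [← ofReal_norm, Complex.norm_real, ← ENNReal.ofReal_pow (norm_nonneg _)]
  congr 1
  -- The squared normalization of `momWave` equals the Jacobian `(2π)^(-d)` of the dilation by `2π`.
  rw [Real.norm_eq_abs, sq_abs, abs_of_pos (by positivity), ← Real.rpow_natCast,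
    ← Real.rpow_mul hpi.le, ← mul_pow, ← Real.rpow_natCast (2 * Real.pi), ← Real.rpow_neg hpi.le]
  congr 1
  push_cast
  ring

instance isFiniteMeasure_momLaw (φ : L2 E) : IsFiniteMeasure (momLaw φ) := by
  rw [momLaw_eq_map]; infer_instance

theorem isProbabilityMeasure_momLaw {φ : L2 E} (h : ‖φ‖ = 1) :
    IsProbabilityMeasure (momLaw φ) := by
  rw [momLaw_eq_map]
  have := isProbabilityMeasure_posLaw (φ := Lp.fourierTransformₗᵢ E ℂ φ) (by simpa using h)
  exact Measure.isProbabilityMeasure_map (measurable_const_smul _).aemeasurable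

theorem posLaw_eq_of_ae_eq {φ : L2 E} {f : E → ℂ} (h : φ =ᵐ[volume] f) :
    posLaw φ = volume.withDensity fun x => ‖f x‖ₑ ^ 2 := by
  refine withDensity_congr_ae ?_
  filter_upwards [h] with x hx
  rw [hx]

/-- For `B` the time-one flow, this expresses statistics after the coupling through those before it:
`B` carries final coordinates to initial ones. -/
theorem map_posLaw_compMeasurePreserving {B : E → E} (hB : MeasurePreserving B volume volume)
    (φ : L2 E) : (posLaw (Lp.compMeasurePreserving B hB φ)).map B = posLaw φ := by
  rw [posLaw_eq_of_ae_eq (Lp.coeFn_compMeasurePreserving φ hB)]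
  have := map_withDensity_comp (μ := (volume : Measure E)) hB.measurable
    (g := fun x => ‖φ x‖ₑ ^ 2) ((measurable_coeFn φ).enorm.pow_const 2)
  rw [hB.map_eq] at this
  exact this

theorem integral_posLaw (φ : L2 E) (g : E → ℝ) :
    ∫ x, g x ∂posLaw φ = ∫ x, ‖φ x‖ ^ 2 * g x := by
  have h := integral_withDensity_eq_integral_smul (μ := (volume : Measure E))
    (f := fun x => ‖φ x‖₊ ^ 2) ((measurable_coeFn φ).nnnorm.pow_const 2) g
  simp only [ENNReal.coe_pow, ← enorm_eq_nnnorm] at h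
  rw [posLaw, h]
  rfl

/-! ### Multiplication operators -/

/-- Multiplication by a bounded measurable real function on `L²`. -/
def mulOp (g : E → ℝ) (hg : MemLp (fun x => (g x : ℂ)) ∞ volume) : L2 E →L[ℂ] L2 E :=
  (ContinuousLinearMap.mul ℂ ℂ).holderL volume ∞ 2 2 (hg.toLp _)

theorem coeFn_mulOp (g : E → ℝ) (hg : MemLp (fun x => (g x : ℂ)) ∞ volume) (φ : L2 E) :
    mulOp g hg φ =ᵐ[volume] fun x => (g x : ℂ) * φ x := by
  have h := (ContinuousLinearMap.mul ℂ ℂ).coeFn_holder (r := 2) (hg.toLp _) φ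
  filter_upwards [h, hg.coeFn_toLp] with x h1 h2
  rw [← h2]
  exact h1

theorem inner_self_eq_integral_of_ae_eq {φ χ : L2 E} {g : E → ℝ}
    (h : χ =ᵐ[volume] fun x => (g x : ℂ) * φ x) :
    inner ℂ φ χ = ((∫ x, g x ∂posLaw φ : ℝ) : ℂ) := by
  rw [L2.inner_def, integral_posLaw, ← integral_complex_ofReal]
  refine integral_congr_ae ?_
  filter_upwards [h] with x hx
  rw [hx, RCLike.inner_apply, mul_assoc, Complex.mul_conj, Complex.normSq_eq_norm_sq]
  push_cast
  ring

theorem memLp_top_of_abs_le {g : E → ℝ} (hg : Measurable g) (hb : ∀ x, |g x| ≤ 1) :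
    MemLp (fun x => (g x : ℂ)) ∞ volume :=
  memLp_top_of_bound (Complex.measurable_ofReal.comp hg).aestronglyMeasurable 1
    (Filter.Eventually.of_forall fun x => by simpa using hb x)

/-- A bounded operator is a multiplication operator as soon as its quadratic form is. -/
theorem ae_eq_mul_of_inner_eq {T : L2 E →L[ℂ] L2 E} {g : E → ℝ} (hg : Measurable g)
    (hb : ∀ x, |g x| ≤ 1) (h : ∀ φ, inner ℂ φ (T φ) = ((∫ x, g x ∂posLaw φ : ℝ) : ℂ))
    (φ : L2 E) : T φ =ᵐ[volume] fun x => (g x : ℂ) * φ x := by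
  have hT : (T : L2 E →ₗ[ℂ] L2 E) = mulOp g (memLp_top_of_abs_le hg hb) := by
    -- On a complex Hilbert space polarization determines an operator from its quadratic form.
    -- `ext_inner_map` has the operator in the first slot, hence the passage to conjugates.
    rw [← ext_inner_map]
    intro χ
    rw [ContinuousLinearMap.coe_coe, ContinuousLinearMap.coe_coe, ← inner_conj_symm,
      ← inner_conj_symm (mulOp g _ χ)]
    congr 1
    exact (h χ).trans (inner_self_eq_integral_of_ae_eq (coeFn_mulOp g _ χ)).symm
  have hTφ : T φ = mulOp g (memLp_top_of_abs_le hg hb) φ := DFunLike.congr_fun hT φ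
  rw [hTφ]
  exact coeFn_mulOp g _ φ

theorem coeFn_indicatorOp {S : Set E} (hS : MeasurableSet S) (φ : L2 E) :
    indicatorOp S φ =ᵐ[volume] fun x => ((S.indicator (fun _ => (1 : ℝ)) x : ℝ) : ℂ) * φ x := by
  rw [indicatorOp, dif_pos hS]
  have hm : MemLp (S.indicator fun _ : E => (1 : ℂ)) ∞ volume :=
    memLp_top_of_bound ((measurable_const.indicator hS).aestronglyMeasurable) 1
      (Filter.Eventually.of_forall fun x => by by_cases h : x ∈ S <;> simp [h])
  have h := (ContinuousLinearMap.mul ℂ ℂ).coeFn_holder (r := 2) (hm.toLp _) φ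
  filter_upwards [h, hm.coeFn_toLp] with x h1 h2
  have h3 : ((S.indicator (fun _ => (1 : ℝ)) x : ℝ) : ℂ) = S.indicator (fun _ => (1 : ℂ)) x := by
    by_cases hx : x ∈ S <;> simp [hx]
  rw [h3, ← h2]
  exact h1

theorem inner_indicatorOp {S : Set E} (hS : MeasurableSet S) (φ : L2 E) :
    inner ℂ φ (indicatorOp S φ) = (((posLaw φ).real S : ℝ) : ℂ) := by
  rw [inner_self_eq_integral_of_ae_eq (coeFn_indicatorOp hS φ), integral_indicator_const _ hS]
  simp

theorem indicatorOp_univ (φ : L2 E) : indicatorOp Set.univ φ = φ := by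
  refine Lp.ext ?_
  filter_upwards [coeFn_indicatorOp MeasurableSet.univ φ] with x hx
  rw [hx]
  simp

end Law

theorem isFunOfPos_of_inner {T : L2 ℝ →L[ℂ] L2 ℝ} {g : ℝ → ℝ} (hg : Measurable g)
    (hb : ∀ x, |g x| ≤ 1) (h : ∀ ψ, inner ℂ ψ (T ψ) = ((∫ x, g x ∂posLaw ψ : ℝ) : ℂ)) :
    IsFunOfPos T g :=
  ae_eq_mul_of_inner_eq hg hb h

/-- Conjugation with the Fourier transform reduces this to multiplication operators, with the symbol
`g(2πξ)` because the momentum is `2πξ`. -/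
theorem isFunOfMom_of_inner {T : L2 ℝ →L[ℂ] L2 ℝ} {g : ℝ → ℝ} (hg : Measurable g)
    (hb : ∀ x, |g x| ≤ 1) (h : ∀ ψ, inner ℂ ψ (T ψ) = ((∫ x, g x ∂momLaw ψ : ℝ) : ℂ)) :
    IsFunOfMom T g := by
  intro ψ
  have hpi : (0 : ℝ) < 2 * Real.pi := by positivity
  let F := Lp.fourierTransformₗᵢ ℝ ℂ
  let T' : L2 ℝ →L[ℂ] L2 ℝ := F.toContinuousLinearEquiv.toContinuousLinearMap ∘L T ∘L
    F.symm.toContinuousLinearEquiv.toContinuousLinearMap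
  have hm : Measurable fun ξ : ℝ => g ((2 * Real.pi) • ξ) := hg.comp (measurable_const_smul _)
  have hT' : ∀ φ, inner ℂ φ (T' φ) =
      ((∫ ξ, g ((2 * Real.pi) • ξ) ∂posLaw φ : ℝ) : ℂ) := by
    intro φ
    have h1 := h (F.symm φ)
    rw [momLaw_eq_map, integral_map (measurable_const_smul _).aemeasurable
      hg.aestronglyMeasurable] at h1
    have h2 : Lp.fourierTransformₗᵢ ℝ ℂ (F.symm φ) = φ := F.apply_symm_apply φ
    rw [h2] at h1
    rw [← h1, ← F.inner_map_map (F.symm φ), F.apply_symm_apply]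
    rfl
  have h3 := ae_eq_mul_of_inner_eq hm (fun ξ => hb _) hT' (F ψ)
  have h4 : T' (F ψ) = F (T ψ) := by
    change F (T (F.symm (F ψ))) = _
    rw [F.symm_apply_apply]
  rw [h4] at h3
  have h5 : Measure.QuasiMeasurePreserving (fun p : ℝ => (2 * Real.pi)⁻¹ • p) volume volume := by
    refine ⟨measurable_const_smul _, ?_⟩
    rw [Measure.map_addHaar_smul _ (inv_ne_zero hpi.ne')]
    exact Measure.smul_absolutelyContinuous
  filter_upwards [h5.ae h3] with p hp
  rw [smul_inv_smul₀ hpi.ne'] at hp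
  rw [momWave, momWave]
  change _ * (F (T ψ)) _ = _
  rw [hp]
  change _ = _ * (_ * (F ψ) _)
  ring

/-! ### Outcome statistics after the coupling -/

theorem measurable_conf_coord {n : ℕ} (j : Fin n) : Measurable fun x : Conf n => x j := by
  fun_prop

/-- This is the source of independence: a product vector has a product distribution, so the system
variable and the noise, a function of the probe variables, are independent. -/
theorem map_split_posLaw_tensor (ψ : L2 ℝ) (φ : L2 (Conf 2)) :
    (posLaw (tensor ψ φ)).map split = (posLaw ψ).prod (posLaw φ) := by
  have h1 : Measurable fun y : ℝ => ‖ψ y‖ₑ ^ 2 := (measurable_coeFn ψ).enorm.pow_const 2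
  have h2 : Measurable fun y : Conf 2 => ‖φ y‖ₑ ^ 2 := (measurable_coeFn φ).enorm.pow_const 2
  rw [posLaw_eq_of_ae_eq (coeFn_tensor ψ φ), posLaw, posLaw, prod_withDensity h1 h2]
  have h3 := map_withDensity_comp (μ := (volume : Measure (Conf 3)))
    measurePreserving_split.measurable
    (g := fun z : ℝ × Conf 2 => ‖ψ z.1‖ₑ ^ 2 * ‖φ z.2‖ₑ ^ 2)
    ((h1.comp measurable_fst).mul (h2.comp measurable_snd))
  rw [measurePreserving_split.map_eq, Measure.volume_eq_prod] at h3
  rw [← h3]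
  congr 2
  funext x
  rw [enorm_mul, mul_pow, split_apply]

/-- The position noise as a function of the probe positions. -/
def noiseQ (lam mu kap : ℝ) (y : Conf 2) : ℝ := mu / 2 * (1 - kap) * y 1 - 1 / lam * y 0

/-- The momentum noise as a function of the probe momenta. -/
def noiseP (lam mu kap : ℝ) (y : Conf 2) : ℝ := lam / 2 * (1 + kap) * y 0 - 1 / mu * y 1

theorem measurable_noiseQ (lam mu kap : ℝ) : Measurable (noiseQ lam mu kap) := by
  unfold noiseQ; fun_prop

theorem measurable_noiseP (lam mu kap : ℝ) : Measurable (noiseP lam mu kap) := by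
  unfold noiseP; fun_prop

theorem measurable_sub_noise {n : Conf 2 → ℝ} (hn : Measurable n) :
    Measurable fun z : ℝ × Conf 2 => z.1 - n z.2 :=
  measurable_fst.sub (hn.comp measurable_snd)

/-- With `y = flow(x)` for final coordinates `x` and initial ones `y`, solving for the pointer gives
`x₁ = lam y₀ + y₁ - (lam mu / 2)(1 - kap) y₂`. Division by `lam` leaves `y₀` minus the noise. -/
theorem posLaw_flowUnitary_tensor {lam : ℝ} (hlam : lam ≠ 0) (mu kap : ℝ) (ψ : L2 ℝ)
    (φ : L2 (Conf 2)) {X : Set ℝ} (hX : MeasurableSet X) :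
    posLaw (flowUnitary lam mu kap 1 (tensor ψ φ)) {x | x 1 ∈ lam • X} =
      ((posLaw ψ).prod (posLaw φ)) {z | z.1 - noiseQ lam mu kap z.2 ∈ X} := by
  have hS : MeasurableSet {z : ℝ × Conf 2 | z.1 - noiseQ lam mu kap z.2 ∈ X} :=
    measurable_sub_noise (measurable_noiseQ lam mu kap) hX
  rw [← map_split_posLaw_tensor, Measure.map_apply measurePreserving_split.measurable hS,
    ← map_posLaw_compMeasurePreserving (measurePreserving_flow lam mu kap 1) (tensor ψ φ),
    Measure.map_apply (measurePreserving_flow lam mu kap 1).measurable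
      (measurePreserving_split.measurable hS), flowUnitary_apply]
  congr 1
  ext x
  simp only [Set.mem_ofPred_eq, Set.mem_preimage, Set.mem_smul_set_iff_inv_smul_mem₀ hlam]
  have : lam⁻¹ • x 1 = (split (flow lam mu kap 1 x)).1
      - noiseQ lam mu kap (split (flow lam mu kap 1 x)).2 := by
    simp [coe_flow, flowFun, split_apply, noiseQ]
    field_simp
    ring
  rw [this]

/-- With `η = dualFlow(ξ)`, inversion gives `ξ₂ = mu η₀ + η₂ - (lam mu / 2)(1 + kap) η₁`. The sign
change from `1 - kap` to `1 + kap` relative to position comes from eliminating `ξ₀ = η₀ - lam η₁`.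
-/
theorem posLaw_fourier_flowUnitary_tensor (lam : ℝ) {mu : ℝ} (hmu : mu ≠ 0) (kap : ℝ) (ψ : L2 ℝ)
    (φ : L2 (Conf 2)) {Y : Set ℝ} (hY : MeasurableSet Y) :
    posLaw (fourierL2 3 (flowUnitary lam mu kap 1 (tensor ψ φ)))
        {ξ | 2 * Real.pi * ξ 2 ∈ mu • Y} =
      ((momLaw ψ).prod (momLaw φ)) {z | z.1 - noiseP lam mu kap z.2 ∈ Y} := by
  have hS : MeasurableSet {z : ℝ × Conf 2 | z.1 - noiseP lam mu kap z.2 ∈ Y} :=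
    measurable_sub_noise (measurable_noiseP lam mu kap) hY
  have hsc : Measurable (Prod.map (fun ξ : ℝ => (2 * Real.pi) • ξ)
      (fun ξ : Conf 2 => (2 * Real.pi) • ξ)) :=
    (measurable_const_smul _).prodMap (measurable_const_smul _)
  rw [momLaw_eq_map, momLaw_eq_map, Measure.map_prod_map _ _ (measurable_const_smul _)
    (measurable_const_smul _), Measure.map_apply hsc hS, ← map_split_posLaw_tensor,
    Measure.map_apply measurePreserving_split.measurable (hsc hS),
    ← map_posLaw_compMeasurePreserving (measurePreserving_dualFlow lam mu kap) (tensor _ _),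
    Measure.map_apply (measurePreserving_dualFlow lam mu kap).measurable
      (measurePreserving_split.measurable (hsc hS)), fourier_flowUnitary, fourier_tensor]
  change posLaw _ _ = posLaw _ _
  congr 1
  ext x
  simp only [Set.mem_ofPred_eq, Set.mem_preimage, Set.mem_smul_set_iff_inv_smul_mem₀ hmu,
    Prod.map_fst, Prod.map_snd]
  have : mu⁻¹ • (2 * Real.pi * x 2) = (2 * Real.pi) • (split (dualFlow lam mu kap x)).1
      - noiseP lam mu kap ((2 * Real.pi) • (split (dualFlow lam mu kap x)).2) := by
    simp [dualFlow, split_apply, noiseP]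
    field_simp
    ring
  rw [this]

/-! ### The probe state -/

namespace ProbeState

variable {ι : Type*} (σ : ProbeState ι)

theorem tsum_ofReal_weight : ∑' i, ENNReal.ofReal (σ.weight i) = 1 := by
  rw [← ENNReal.ofReal_tsum_of_nonneg σ.weight_nonneg σ.weight_sum.summable,
    σ.weight_sum.tsum_eq, ENNReal.ofReal_one]

/-- The mixture of probability measures with the weights of `σ`. -/
def mix {Ω : Type*} [MeasurableSpace Ω] (ν : ι → Measure Ω) : Measure Ω :=
  Measure.sum fun i => ENNReal.ofReal (σ.weight i) • ν i

theorem isProbabilityMeasure_mix {Ω : Type*} [MeasurableSpace Ω] {ν : ι → Measure Ω}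
    (hν : ∀ i, IsProbabilityMeasure (ν i)) : IsProbabilityMeasure (σ.mix ν) :=
  ⟨by simp [mix, Measure.sum_apply _ MeasurableSet.univ, σ.tsum_ofReal_weight]⟩

instance isProbabilityMeasure_posLaw : IsProbabilityMeasure σ.posLaw :=
  σ.isProbabilityMeasure_mix fun i => ArthursKelly.isProbabilityMeasure_posLaw (σ.norm_vec i)

instance isProbabilityMeasure_momLaw : IsProbabilityMeasure σ.momLaw :=
  σ.isProbabilityMeasure_mix fun i => ArthursKelly.isProbabilityMeasure_momLaw (σ.norm_vec i)

theorem hasSum_prod_mix_real [Countable ι] {Ω : Type*} [MeasurableSpace Ω] {ν : ι → Measure Ω}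
    (hν : ∀ i, IsProbabilityMeasure (ν i)) (ρ : Measure ℝ) [IsFiniteMeasure ρ]
    {S : Set (ℝ × Ω)} (hS : MeasurableSet S) :
    HasSum (fun i => σ.weight i * (ρ.prod (ν i)).real S) ((ρ.prod (σ.mix ν)).real S) := by
  have := σ.isProbabilityMeasure_mix hν
  have h1 : (ρ.prod (σ.mix ν)) S = ∑' i, ENNReal.ofReal (σ.weight i) * (ρ.prod (ν i)) S := by
    rw [mix, Measure.prod_sum_right, Measure.sum_apply _ hS]
    simp [Measure.prod_smul_right]
  have h2 : ∑' i, ENNReal.ofReal (σ.weight i) * (ρ.prod (ν i)) S ≠ ∞ := by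
    rw [← h1]; exact measure_ne_top _ _
  have h3 := ENNReal.hasSum_toReal h2
  rw [measureReal_def, h1, ENNReal.tsum_toReal_eq (ENNReal.ne_top_of_tsum_ne_top h2)]
  convert h3.summable.hasSum using 1
  funext i
  rw [ENNReal.toReal_mul, ENNReal.toReal_ofReal (σ.weight_nonneg i), measureReal_def]

end ProbeState

/-! ### Effective observables as measurements with additive noise. -/

section Effective

variable {ι : Type*}

/-- The terms are bounded in operator norm by `σ.weight i * ‖M‖`, so the series defining `effective`
converges in norm and the continuous functional `T ↦ ⟨ψ, Tψ⟩` may be applied term by term. -/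
theorem hasSum_inner_effective (U : L2 (Conf 3) ≃ₗᵢ[ℂ] L2 (Conf 3)) (σ : ProbeState ι)
    (M : L2 (Conf 3) →L[ℂ] L2 (Conf 3)) (ψ : L2 ℝ) :
    HasSum (fun i => (σ.weight i : ℂ) *
      inner ℂ (U (tensor ψ (σ.vec i))) (M (U (tensor ψ (σ.vec i)))))
      (inner ℂ ψ (effective U σ M ψ)) := by
  set A : ι → L2 ℝ →L[ℂ] L2 (Conf 3) := fun i =>
    U.toContinuousLinearEquiv.toContinuousLinearMap ∘L tensorL (σ.vec i) with hA
  have hAn : ∀ i, ‖A i‖ ≤ 1 := fun i => by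
    refine ContinuousLinearMap.opNorm_le_bound _ zero_le_one fun χ => ?_
    change ‖U (tensor χ (σ.vec i))‖ ≤ _
    rw [U.norm_map, norm_tensor, σ.norm_vec, mul_one, one_mul]
  have hs : Summable fun i => (σ.weight i : ℂ) •
      (ContinuousLinearMap.adjoint (A i) ∘L M ∘L A i) := by
    refine Summable.of_norm_bounded (σ.weight_sum.summable.mul_right ‖M‖) fun i => ?_
    rw [norm_smul, Complex.norm_real, Real.norm_of_nonneg (σ.weight_nonneg i)]
    refine mul_le_mul_of_nonneg_left ?_ (σ.weight_nonneg i)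
    calc _ ≤ ‖ContinuousLinearMap.adjoint (A i)‖ * (‖M‖ * ‖A i‖) :=
          (ContinuousLinearMap.opNorm_comp_le _ _).trans
            (mul_le_mul_of_nonneg_left (ContinuousLinearMap.opNorm_comp_le _ _) (norm_nonneg _))
      _ ≤ 1 * (‖M‖ * 1) := by
          gcongr
          · simpa using hAn i
          · exact hAn i
      _ = ‖M‖ := by ring
  have h1 := hs.hasSum.mapL (innerSL ℂ ψ ∘L ContinuousLinearMap.apply ℂ (L2 ℝ) ψ)
  refine HasSum.congr_fun h1 ?_
  intro i
  simp only [ContinuousLinearMap.comp_apply, ContinuousLinearMap.apply_apply, smul_apply,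
    innerSL_apply_apply, inner_smul_right, ContinuousLinearMap.adjoint_inner_right]
  rfl

/-- The observable `A` is, in the statistics described by `law`, a measurement with independent
additive noise: its outcomes are distributed like `a - t` with `a` distributed according to `law ψ`
and `t` according to `N`. -/
def HasNoiseLaw (law : L2 ℝ → Measure ℝ) (A : Set ℝ → (L2 ℝ →L[ℂ] L2 ℝ)) (N : Measure ℝ) : Prop :=
  ∀ X, MeasurableSet X → ∀ ψ,
    inner ℂ ψ (A X ψ) = ((((law ψ).prod N).real {z | z.1 - z.2 ∈ X} : ℝ) : ℂ)

/-- The system law `ρ` and the noise function `n` are the same for all components of the mixture, so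
averaging over `i` changes only the probe law. -/
theorem inner_effective_eq [Countable ι] (U : L2 (Conf 3) ≃ₗᵢ[ℂ] L2 (Conf 3)) (σ : ProbeState ι)
    (M : L2 (Conf 3) →L[ℂ] L2 (Conf 3)) (ψ : L2 ℝ) (ρ : Measure ℝ) [IsFiniteMeasure ρ]
    {ν : ι → Measure (Conf 2)} (hν : ∀ i, IsProbabilityMeasure (ν i)) {n : Conf 2 → ℝ}
    (hn : Measurable n) {X : Set ℝ} (hX : MeasurableSet X)
    (h : ∀ i, inner ℂ (U (tensor ψ (σ.vec i))) (M (U (tensor ψ (σ.vec i)))) =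
      (((ρ.prod (ν i)).real {z | z.1 - n z.2 ∈ X} : ℝ) : ℂ)) :
    inner ℂ ψ (effective U σ M ψ) =
      (((ρ.prod ((σ.mix ν).map n)).real {z | z.1 - z.2 ∈ X} : ℝ) : ℂ) := by
  have := σ.isProbabilityMeasure_mix hν
  have hS : MeasurableSet {z : ℝ × Conf 2 | z.1 - n z.2 ∈ X} := measurable_sub_noise hn hX
  have hS' : MeasurableSet {z : ℝ × ℝ | z.1 - z.2 ∈ X} :=
    (measurable_fst.sub measurable_snd) hX
  have h1 := hasSum_inner_effective U σ M ψ
  simp only [h] at h1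
  have h2 := Complex.hasSum_ofReal.2 (σ.hasSum_prod_mix_real hν ρ hS)
  push_cast at h2
  rw [h1.unique h2]
  congr 1
  have h3 := Measure.map_prod_map ρ (σ.mix ν) measurable_id hn
  rw [Measure.map_id] at h3
  rw [h3, measureReal_def, measureReal_def,
    Measure.map_apply (measurable_id.prodMap hn) hS']
  rfl

theorem inner_posProj {n : ℕ} (j : Fin n) {X : Set ℝ} (hX : MeasurableSet X) (Ψ : L2 (Conf n)) :
    inner ℂ Ψ (posProj j X Ψ) = (((posLaw Ψ).real {x | x j ∈ X} : ℝ) : ℂ) :=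
  inner_indicatorOp (measurable_conf_coord j hX) Ψ

theorem inner_momProj {n : ℕ} (j : Fin n) {Y : Set ℝ} (hY : MeasurableSet Y) (Ψ : L2 (Conf n)) :
    inner ℂ Ψ (momProj j Y Ψ) =
      (((posLaw (fourierL2 n Ψ)).real {ξ | 2 * Real.pi * ξ j ∈ Y} : ℝ) : ℂ) := by
  have hS : MeasurableSet {ξ : Conf n | 2 * Real.pi * ξ j ∈ Y} :=
    ((measurable_conf_coord j).const_mul (2 * Real.pi)) hY
  rw [← inner_indicatorOp hS,
    ← (fourierL2 n).inner_map_map]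
  congr 1
  exact (fourierL2 n).apply_symm_apply _

theorem posProj_univ {n : ℕ} (j : Fin n) :
    posProj j Set.univ = ContinuousLinearMap.id ℂ (L2 (Conf n)) := by
  ext1 Ψ
  exact indicatorOp_univ Ψ

theorem momProj_univ {n : ℕ} (j : Fin n) :
    momProj j Set.univ = ContinuousLinearMap.id ℂ (L2 (Conf n)) := by
  ext1 Ψ
  change (fourierL2 n).symm (indicatorOp Set.univ (fourierL2 n Ψ)) = Ψ
  rw [indicatorOp_univ, (fourierL2 n).symm_apply_apply]

theorem measurableSet_smul_real {c : ℝ} (hc : c ≠ 0) {X : Set ℝ} (hX : MeasurableSet X) :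
    MeasurableSet (c • X) := hX.const_smul_of_ne_zero hc

theorem hasNoiseLaw_posProj [Countable ι] {lam : ℝ} (hlam : lam ≠ 0) (mu kap : ℝ)
    (σ : ProbeState ι) :
    HasNoiseLaw posLaw (fun X => effective (coupling lam mu kap) σ (posProj 1 (lam • X)))
      (σ.posLaw.map (noiseQ lam mu kap)) := by
  intro X hX ψ
  refine inner_effective_eq _ σ _ ψ (posLaw ψ)
    (fun i => ArthursKelly.isProbabilityMeasure_posLaw (σ.norm_vec i))
    (measurable_noiseQ lam mu kap) hX fun i => ?_
  rw [inner_posProj 1 (measurableSet_smul_real hlam hX), coupling_eq_flowUnitary, measureReal_def,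
    posLaw_flowUnitary_tensor hlam mu kap ψ _ hX, measureReal_def]

theorem hasNoiseLaw_momProj [Countable ι] (lam : ℝ) {mu : ℝ} (hmu : mu ≠ 0) (kap : ℝ)
    (σ : ProbeState ι) :
    HasNoiseLaw momLaw (fun Y => effective (coupling lam mu kap) σ (momProj 2 (mu • Y)))
      (σ.momLaw.map (noiseP lam mu kap)) := by
  intro Y hY ψ
  refine inner_effective_eq _ σ _ ψ (momLaw ψ)
    (fun i => ArthursKelly.isProbabilityMeasure_momLaw (σ.norm_vec i))
    (measurable_noiseP lam mu kap) hY fun i => ?_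
  rw [inner_momProj 2 (measurableSet_smul_real hmu hY), coupling_eq_flowUnitary, measureReal_def,
    posLaw_fourier_flowUnitary_tensor lam hmu kap ψ _ hY, measureReal_def]

theorem hasNoiseLaw_obsE [Countable ι] {lam mu : ℝ} (hlam : lam ≠ 0) (hmu : mu ≠ 0) (kap : ℝ)
    (σ : ProbeState ι) :
    HasNoiseLaw posLaw (obsE lam mu kap σ) (σ.posLaw.map (noiseQ lam mu kap)) := by
  convert hasNoiseLaw_posProj hlam mu kap σ using 2
  -- Because `mu ≠ 0`, scaling the whole line gives the whole line, and the momentum projection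
  -- becomes the identity.
  rw [obsE, obsG, Set.smul_set_univ₀ hmu, momProj_univ, ContinuousLinearMap.comp_id]

theorem hasNoiseLaw_obsF [Countable ι] {lam mu : ℝ} (hlam : lam ≠ 0) (hmu : mu ≠ 0) (kap : ℝ)
    (σ : ProbeState ι) :
    HasNoiseLaw momLaw (obsF lam mu kap σ) (σ.momLaw.map (noiseP lam mu kap)) := by
  convert hasNoiseLaw_momProj lam hmu kap σ using 2
  rw [obsF, obsG, Set.smul_set_univ₀ hlam, posProj_univ, ContinuousLinearMap.id_comp]

theorem hasNoiseLaw_obsE0 [Countable ι] {lam : ℝ} (hlam : lam ≠ 0) (kap : ℝ) (σ : ProbeState ι) :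
    HasNoiseLaw posLaw (obsE0 lam kap σ) (σ.posLaw.map (noiseQ lam 0 kap)) :=
  hasNoiseLaw_posProj hlam 0 kap σ

theorem hasNoiseLaw_obsF0 [Countable ι] {mu : ℝ} (hmu : mu ≠ 0) (kap : ℝ) (σ : ProbeState ι) :
    HasNoiseLaw momLaw (obsF0 mu kap σ) (σ.momLaw.map (noiseP 0 mu kap)) :=
  hasNoiseLaw_momProj 0 hmu kap σ

end Effective

/-! ### Densities of the noise laws -/

/-- `e` is a density of the measure `N`. -/
def IsDensityOf (e : ℝ → ℝ) (N : Measure ℝ) : Prop :=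
  (∀ q, 0 ≤ e q) ∧ AEMeasurable e ∧ N = volume.withDensity fun q => ENNReal.ofReal (e q)

section Marginal

variable {c : ℝ × ℝ → Conf 2} {n : Conf 2 → ℝ} {K : ℝ}

/-- In the coordinates `c` the function `n` is the first variable, so its law is found by
integrating out the second; `K` is the Jacobian of `c`. -/
theorem map_withDensity_eq_of_comp_eq_fst (hc : Measurable c) (hn : Measurable n)
    (hvol : (volume : Measure (Conf 2)) = ENNReal.ofReal K • (volume : Measure (ℝ × ℝ)).map c)
    (hnc : ∀ z, n (c z) = z.1) {g : Conf 2 → ℝ≥0∞} (hg : Measurable g) :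
    (volume.withDensity g).map n =
      volume.withDensity fun q => ENNReal.ofReal K * ∫⁻ q', g (c (q, q')) := by
  ext s hs
  have hpre : c ⁻¹' (n ⁻¹' s) = s ×ˢ (Set.univ : Set ℝ) := by
    ext z; simp [hnc]
  have hgc : Measurable fun z => g (c z) := hg.comp hc
  rw [Measure.map_apply hn hs, withDensity_apply _ (hn hs), withDensity_apply _ hs]
  conv_lhs => rw [hvol]
  rw [Measure.restrict_smul, lintegral_smul_measure, setLIntegral_map (hn hs) hg hc, hpre,
    Measure.volume_eq_prod, setLIntegral_prod _ hgc.aemeasurable, smul_eq_mul,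
    ← lintegral_const_mul' _ _ ENNReal.ofReal_ne_top]
  simp only [Measure.restrict_univ]

/-- The computation takes place in `ℝ≥0∞`, where sums and integrals commute freely, and is then
compared with the real-valued formula `he`. One lemma serves position and momentum, for two probes
and for one. -/
theorem isDensityOf_map_mix {ι : Type*} [Countable ι] (σ : ProbeState ι) {w : ι → Conf 2 → ℂ}
    (hw : ∀ i, Measurable (w i)) (hK : 0 ≤ K) (hc : Measurable c) (hn : Measurable n)
    (hvol : (volume : Measure (Conf 2)) = ENNReal.ofReal K • (volume : Measure (ℝ × ℝ)).map c)
    (hnc : ∀ z, n (c z) = z.1) {P : Measure (Conf 2)} [IsProbabilityMeasure P]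
    (hP : P = σ.mix fun i => volume.withDensity fun y => ‖w i y‖ₑ ^ 2) {e : ℝ → ℝ}
    (he : ∀ q, e q = K * ∑' i, σ.weight i * ∫ q', ‖w i (c (q, q'))‖ ^ 2) :
    IsDensityOf e (P.map n) := by
  obtain rfl : e = fun q => K * ∑' i, σ.weight i * ∫ q', ‖w i (c (q, q'))‖ ^ 2 := funext he
  have hg : ∀ i, Measurable fun y => ‖w i y‖ₑ ^ 2 := fun i => (hw i).enorm.pow_const 2
  let l : ι → ℝ → ℝ≥0∞ := fun i q => ∫⁻ q', ‖w i (c (q, q'))‖ₑ ^ 2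
  have hl : ∀ i, Measurable (l i) := fun i =>
    Measurable.lintegral_prod_right' (f := fun z : ℝ × ℝ => ‖w i (c z)‖ₑ ^ 2) ((hg i).comp hc)
  let t : ι → ℝ → ℝ≥0∞ := fun i q =>
    ENNReal.ofReal (σ.weight i) * (ENNReal.ofReal K * l i q)
  have ht : ∀ i, Measurable (t i) := fun i => ((hl i).const_mul _).const_mul _
  have hmap : P.map n = volume.withDensity (∑' i, t i) := by
    rw [withDensity_tsum ht, hP, ProbeState.mix, Measure.map_sum hn.aemeasurable]
    congr 1
    funext i
    rw [Measure.map_smul, map_withDensity_eq_of_comp_eq_fst hc hn hvol hnc (hg i),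
      ← withDensity_smul _ ((hl i).const_mul _)]
    rfl
  have htm : Measurable (∑' i, t i) := by
    have : (∑' i, t i) = fun q => ∑' i, t i q := by
      funext q; exact tsum_apply (Pi.summable.2 fun q => ENNReal.summable)
    rw [this]
    exact Measurable.tsum ht
  -- Where the extended sum is infinite, the real `tsum` and integrals may take default values.
  -- Total mass one confines this to a null set.
  have hfin : ∀ᵐ q, (∑' i, t i) q < ∞ := by
    have hone : (P.map n) Set.univ = 1 := by
      rw [Measure.map_apply hn MeasurableSet.univ]; exact measure_univ
    rw [hmap, withDensity_apply _ MeasurableSet.univ, Measure.restrict_univ] at hone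
    exact ae_lt_top htm (by rw [hone]; exact ENNReal.one_ne_top)
  have hae : (fun q => K * ∑' i, σ.weight i * ∫ q', ‖w i (c (q, q'))‖ ^ 2) =ᵐ[volume]
      fun q => ((∑' i, t i) q).toReal := by
    filter_upwards [hfin] with q hq
    have hq' : (∑' i, t i) q = ∑' i, t i q :=
      tsum_apply (Pi.summable.2 fun q => ENNReal.summable)
    rw [hq'] at hq
    rw [hq', ENNReal.tsum_toReal_eq (ENNReal.ne_top_of_tsum_ne_top hq.ne), ← tsum_mul_left]
    congr 1
    funext i
    have hint : ∫ q', ‖w i (c (q, q'))‖ ^ 2 = (l i q).toReal := by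
      have hm : Measurable fun q' => ‖w i (c (q, q'))‖ ^ 2 :=
        ((hw i).comp (hc.comp measurable_prodMk_left)).norm.pow_const 2
      rw [integral_eq_lintegral_of_nonneg_ae (Filter.Eventually.of_forall fun _ => by positivity)
        hm.aestronglyMeasurable]
      congr 2
      funext q'
      rw [ENNReal.ofReal_pow (norm_nonneg _), ofReal_norm]
    rw [hint, ENNReal.toReal_mul, ENNReal.toReal_mul, ENNReal.toReal_ofReal hK,
      ENNReal.toReal_ofReal (σ.weight_nonneg i)]
    ring
  refine ⟨fun q => mul_nonneg hK (tsum_nonneg fun i => mul_nonneg (σ.weight_nonneg i)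
    (integral_nonneg fun _ => by positivity)), ⟨_, htm.ennreal_toReal, hae⟩, ?_⟩
  rw [hmap]
  refine withDensity_congr_ae ?_
  filter_upwards [hae, hfin] with q h1 h2
  rw [h1, ENNReal.ofReal_toReal h2.ne]

theorem volume_eq_smul_map_matrix (M : Matrix (Fin 2) (Fin 2) ℝ) (hM : M.det ≠ 0)
    (hc : ∀ z : ℝ × ℝ, c z = !₂[M 0 0 * z.1 + M 0 1 * z.2, M 1 0 * z.1 + M 1 1 * z.2]) :
    (volume : Measure (Conf 2)) =
      ENNReal.ofReal |M.det| • (volume : Measure (ℝ × ℝ)).map c := by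
  have h1 := (volume_preserving_finTwoArrow ℝ).symm
  have h2 := (PiLp.volume_preserving_toLp (Fin 2)).comp h1
  have hmm : Measurable fun x : Conf 2 =>
      (WithLp.toLp 2 (M.mulVec (WithLp.ofLp x)) : Conf 2) := by
    have : Continuous fun x : Conf 2 =>
        (WithLp.toLp 2 (M.mulVec (WithLp.ofLp x)) : Conf 2) :=
      (PiLp.continuous_toLp 2 _).comp
        ((continuous_const.matrix_mulVec (PiLp.continuous_ofLp 2 _)))
    exact this.measurable
  have h3 := map_volume_matrix M hM
  have he : c = (fun x : Conf 2 => (WithLp.toLp 2 (M.mulVec (WithLp.ofLp x)) : Conf 2)) ∘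
      (WithLp.toLp 2 ∘ MeasurableEquiv.finTwoArrow.symm) := by
    funext z
    ext i
    fin_cases i <;> simp [hc]
  rw [he, ← Measure.map_map hmm h2.measurable, h2.map_eq, h3, smul_smul,
    ← ENNReal.ofReal_mul (abs_nonneg _), ← abs_mul, mul_inv_cancel₀ hM]
  simp

end Marginal

theorem measurable_conf_two {f g : ℝ × ℝ → ℝ} (hf : Measurable f) (hg : Measurable g) :
    Measurable fun z => (!₂[f z, g z] : Conf 2) := by
  refine (PiLp.volume_preserving_toLp (Fin 2)).measurable.comp (measurable_pi_lambda _ fun i => ?_)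
  fin_cases i
  · exact hf
  · exact hg

/-! ### Adapted coordinates for the four noises. -/

section NoiseDensities

variable {ι : Type*} [Countable ι]

theorem isDensityOf_noiseE {lam mu : ℝ} (hlam : 0 < lam) (hmu : 0 < mu) (kap : ℝ)
    (σ : ProbeState ι) :
    IsDensityOf (noiseE lam mu kap σ) (σ.posLaw.map (noiseQ lam mu kap)) := by
  -- The coordinates are `q = noiseQ` and `q' = mu q₂`. The matrix expresses `(q₁, q₂)` through
  -- them, and the modulus of its determinant is the prefactor of `noiseE`.
  have hdet : (!![-lam, lam * ((1 - kap) / 2); 0, 1 / mu] : Matrix (Fin 2) (Fin 2) ℝ).det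
      = -(lam / mu) := by
    rw [Matrix.det_fin_two_of]; ring
  have hpos : 0 < lam / mu := by positivity
  have hvol := volume_eq_smul_map_matrix
    (c := fun z => !₂[lam * ((1 - kap) / 2 * z.2 - z.1), z.2 / mu])
    !![-lam, lam * ((1 - kap) / 2); 0, 1 / mu] (by rw [hdet]; exact neg_ne_zero.2 hpos.ne')
    (fun z => by ext i; fin_cases i <;> simp <;> ring)
  rw [hdet, abs_neg, abs_of_pos hpos] at hvol
  exact isDensityOf_map_mix σ (P := σ.posLaw) (w := fun i y => σ.vec i y)
    (fun i => measurable_coeFn _) hpos.le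
    (measurable_conf_two (by fun_prop) (by fun_prop)) (measurable_noiseQ lam mu kap) hvol
    (fun z => by simp [noiseQ]; field_simp; ring) rfl fun q => rfl

theorem isDensityOf_noiseF {lam mu : ℝ} (hlam : 0 < lam) (hmu : 0 < mu) (kap : ℝ)
    (σ : ProbeState ι) :
    IsDensityOf (noiseF lam mu kap σ) (σ.momLaw.map (noiseP lam mu kap)) := by
  -- Here the coordinates are `p = noiseP` and `w = lam p₁`.
  have hdet : (!![0, 1 / lam; -mu, mu * ((kap + 1) / 2)] : Matrix (Fin 2) (Fin 2) ℝ).det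
      = mu / lam := by
    rw [Matrix.det_fin_two_of]; ring
  have hpos : 0 < mu / lam := by positivity
  have hvol := volume_eq_smul_map_matrix
    (c := fun z => !₂[z.2 / lam, mu * (z.2 / 2 * (kap + 1) - z.1)])
    !![0, 1 / lam; -mu, mu * ((kap + 1) / 2)] (by rw [hdet]; exact hpos.ne')
    (fun z => by ext i; fin_cases i <;> simp <;> ring)
  rw [hdet, abs_of_pos hpos] at hvol
  exact isDensityOf_map_mix σ (P := σ.momLaw) (w := fun i => momWave (σ.vec i))
    (fun i => measurable_momWave _)
    hpos.le (measurable_conf_two (by fun_prop) (by fun_prop)) (measurable_noiseP lam mu kap) hvol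
    (fun z => by simp [noiseP]; field_simp; ring) rfl fun q => rfl

theorem isDensityOf_noiseE0 {lam : ℝ} (hlam : 0 < lam) (kap : ℝ) (σ : ProbeState ι) :
    IsDensityOf (noiseE0 lam σ) (σ.posLaw.map (noiseQ lam 0 kap)) := by
  have hdet : (!![-lam, 0; 0, 1] : Matrix (Fin 2) (Fin 2) ℝ).det = -lam := by
    rw [Matrix.det_fin_two_of]; ring
  have hvol := volume_eq_smul_map_matrix (c := fun z => !₂[-(lam * z.1), z.2])
    !![-lam, 0; 0, 1] (by rw [hdet]; exact neg_ne_zero.2 hlam.ne')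
    (fun z => by ext i; fin_cases i <;> simp)
  rw [hdet, abs_neg, abs_of_pos hlam] at hvol
  exact isDensityOf_map_mix σ (P := σ.posLaw) (w := fun i y => σ.vec i y)
    (fun i => measurable_coeFn _) hlam.le
    (measurable_conf_two (by fun_prop) (by fun_prop)) (measurable_noiseQ lam 0 kap) hvol
    (fun z => by simp [noiseQ]; field_simp) rfl fun q => rfl

theorem isDensityOf_noiseF0 {mu : ℝ} (hmu : 0 < mu) (kap : ℝ) (σ : ProbeState ι) :
    IsDensityOf (noiseF0 mu σ) (σ.momLaw.map (noiseP 0 mu kap)) := by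
  have hdet : (!![0, 1; -mu, 0] : Matrix (Fin 2) (Fin 2) ℝ).det = mu := by
    rw [Matrix.det_fin_two_of]; ring
  have hvol := volume_eq_smul_map_matrix (c := fun z => !₂[z.2, -(mu * z.1)])
    !![0, 1; -mu, 0] (by rw [hdet]; exact hmu.ne')
    (fun z => by ext i; fin_cases i <;> simp)
  rw [hdet, abs_of_pos hmu] at hvol
  exact isDensityOf_map_mix σ (P := σ.momLaw) (w := fun i => momWave (σ.vec i))
    (fun i => measurable_momWave _)
    hmu.le (measurable_conf_two (by fun_prop) (by fun_prop)) (measurable_noiseP 0 mu kap) hvol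
    (fun z => by simp [noiseP]; field_simp) rfl fun q => rfl

end NoiseDensities

/-! ### Consequences of having a density -/

namespace IsDensityOf

variable {e : ℝ → ℝ} {N : Measure ℝ}

theorem integrable_iff (h : IsDensityOf e N) {g : ℝ → ℝ} :
    Integrable g N ↔ Integrable fun q => g q * e q := by
  rw [h.2.2, integrable_withDensity_iff_integrable_smul₀' h.2.1.ennreal_ofReal
    (Filter.Eventually.of_forall fun _ => ENNReal.ofReal_lt_top)]
  simp only [ENNReal.toReal_ofReal (h.1 _), smul_eq_mul, mul_comm]

theorem integral_eq (h : IsDensityOf e N) (g : ℝ → ℝ) : ∫ q, g q ∂N = ∫ q, g q * e q := by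
  rw [h.2.2, integral_withDensity_eq_integral_toReal_smul₀ h.2.1.ennreal_ofReal
    (Filter.Eventually.of_forall fun _ => ENNReal.ofReal_lt_top)]
  simp only [ENNReal.toReal_ofReal (h.1 _), smul_eq_mul, mul_comm]

theorem isProbDensity [IsProbabilityMeasure N] (h : IsDensityOf e N) : IsProbDensity e := by
  refine ⟨h.1, ?_, ?_⟩
  · simpa using (h.integrable_iff (g := fun _ => 1)).1 (integrable_const 1)
  · simpa using (h.integral_eq fun _ => 1).symm

/-- The reflection `t ↦ a - t` in the convolution integral turns it into the probability that `a`
minus the noise falls in `X`. -/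
theorem smear_eq (h : IsDensityOf e N) {X : Set ℝ} (hX : MeasurableSet X) (a : ℝ) :
    smear X e a = N.real {t | a - t ∈ X} := by
  have hS : MeasurableSet {t | a - t ∈ X} := (measurable_const.sub measurable_id) hX
  rw [smear, convolution_def]
  have h1 := integral_sub_left_eq_self
    (fun t => X.indicator (fun _ => (1 : ℝ)) (a - t) * e t) volume a
  simp only [sub_sub_cancel] at h1
  simp only [ContinuousLinearMap.mul_apply']
  rw [h1]
  have h2 := h.integral_eq ({t | a - t ∈ X}.indicator fun _ => (1 : ℝ))
  rw [integral_indicator_const _ hS, smul_eq_mul, mul_one] at h2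
  rw [h2]
  rfl

theorem moment1_eq (h : IsDensityOf e N) : moment1 e = ∫ q, q ∂N := (h.integral_eq fun q => q).symm

theorem moment2_eq (h : IsDensityOf e N) : moment2 e = ∫ q, q ^ 2 ∂N :=
  (h.integral_eq fun q => q ^ 2).symm

theorem densityVar_eq [IsProbabilityMeasure N] (h : IsDensityOf e N) :
    densityVar e = ProbabilityTheory.variance id N := by
  rw [ProbabilityTheory.variance_eq_integral aemeasurable_id, densityVar, h.moment1_eq,
    ← h.integral_eq fun q => (q - ∫ t, t ∂N) ^ 2]
  rfl

end IsDensityOf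

/-! ### Consequences of a noise law -/

section NoiseLaw

variable {law : L2 ℝ → Measure ℝ} {A : Set ℝ → (L2 ℝ →L[ℂ] L2 ℝ)} {N : Measure ℝ}
  [IsProbabilityMeasure N]

theorem measurableSet_sub_mem {X : Set ℝ} (hX : MeasurableSet X) :
    MeasurableSet {z : ℝ × ℝ | z.1 - z.2 ∈ X} :=
  (measurable_fst.sub measurable_snd) hX

theorem measurable_smear {e : ℝ → ℝ} (h : IsDensityOf e N) {X : Set ℝ} (hX : MeasurableSet X) :
    Measurable (smear X e) := by
  have : smear X e = fun a => (N (Prod.mk a ⁻¹' {z : ℝ × ℝ | z.1 - z.2 ∈ X})).toReal :=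
    funext fun a => h.smear_eq hX a
  rw [this]
  exact (measurable_measure_prodMk_left (measurableSet_sub_mem hX)).ennreal_toReal

theorem abs_smear_le {e : ℝ → ℝ} (h : IsDensityOf e N) {X : Set ℝ} (hX : MeasurableSet X) (a : ℝ) :
    |smear X e a| ≤ 1 := by
  rw [h.smear_eq hX, abs_of_nonneg measureReal_nonneg]
  exact measureReal_le_one

theorem HasNoiseLaw.inner_eq_integral_smear (hA : HasNoiseLaw law A N) {e : ℝ → ℝ}
    (h : IsDensityOf e N) {X : Set ℝ} (hX : MeasurableSet X) (ψ : L2 ℝ)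
    [IsFiniteMeasure (law ψ)] :
    inner ℂ ψ (A X ψ) = ((∫ a, smear X e a ∂law ψ : ℝ) : ℂ) := by
  rw [hA X hX ψ, measureReal_def, Measure.prod_apply (measurableSet_sub_mem hX),
    ← integral_toReal (measurable_measure_prodMk_left (measurableSet_sub_mem hX)).aemeasurable
      (Filter.Eventually.of_forall fun _ => measure_lt_top _ _)]
  congr 2
  funext a
  exact (h.smear_eq hX a).symm

theorem HasNoiseLaw.isFunOfPos (hA : HasNoiseLaw posLaw A N) {e : ℝ → ℝ}
    (h : IsDensityOf e N) {X : Set ℝ} (hX : MeasurableSet X) : IsFunOfPos (A X) (smear X e) :=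
  isFunOfPos_of_inner (measurable_smear h hX) (abs_smear_le h hX)
    fun ψ => hA.inner_eq_integral_smear h hX ψ

theorem HasNoiseLaw.isFunOfMom (hA : HasNoiseLaw momLaw A N) {e : ℝ → ℝ}
    (h : IsDensityOf e N) {X : Set ℝ} (hX : MeasurableSet X) : IsFunOfMom (A X) (smear X e) :=
  isFunOfMom_of_inner (measurable_smear h hX) (abs_smear_le h hX)
    fun ψ => hA.inner_eq_integral_smear h hX ψ

theorem IsOutcomeLaw.eq {ψ : L2 ℝ} {ν ν' : Measure ℝ} (h : IsOutcomeLaw A ψ ν)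
    (h' : IsOutcomeLaw A ψ ν') : ν = ν' := by
  have := h.1
  have := h'.1
  ext X hX
  have h1 : ν.real X = ν'.real X := by exact_mod_cast (h.2 X hX).trans (h'.2 X hX).symm
  rwa [measureReal_def, measureReal_def,
    ENNReal.toReal_eq_toReal_iff' (measure_ne_top _ _) (measure_ne_top _ _)] at h1

theorem outcomeLaw_eq {ψ : L2 ℝ} {ν : Measure ℝ} (h : IsOutcomeLaw A ψ ν) :
    outcomeLaw A ψ = ν :=
  IsOutcomeLaw.eq (Classical.epsilon_spec ⟨ν, h⟩) h

variable {ψ : L2 ℝ} [IsProbabilityMeasure (law ψ)]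

theorem HasNoiseLaw.isOutcomeLaw (hA : HasNoiseLaw law A N) :
    IsOutcomeLaw A ψ (((law ψ).prod N).map fun z => z.1 - z.2) := by
  have hm : Measurable fun z : ℝ × ℝ => z.1 - z.2 := measurable_fst.sub measurable_snd
  refine ⟨Measure.isProbabilityMeasure_map hm.aemeasurable, fun X hX => ?_⟩
  rw [hA X hX ψ, measureReal_def, Measure.map_apply hm hX]
  rfl

theorem memLp_fst_snd (hρ : Integrable (fun x => x ^ 2) (law ψ))
    (hN : Integrable (fun x => x ^ 2) N) :
    MemLp (fun z : ℝ × ℝ => z.1) 2 ((law ψ).prod N) ∧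
      MemLp (fun z : ℝ × ℝ => z.2) 2 ((law ψ).prod N) := by
  have h1 : MemLp id 2 (law ψ) := (memLp_two_iff_integrable_sq aestronglyMeasurable_id).2 hρ
  have h2 : MemLp id 2 N := (memLp_two_iff_integrable_sq aestronglyMeasurable_id).2 hN
  exact ⟨h1.comp_fst N, h2.comp_snd (law ψ)⟩

theorem HasNoiseLaw.hasFiniteVar (hA : HasNoiseLaw law A N)
    (hρ : Integrable (fun x => x ^ 2) (law ψ)) (hN : Integrable (fun x => x ^ 2) N) :
    HasFiniteVar A ψ := by
  have hm : Measurable fun z : ℝ × ℝ => z.1 - z.2 := measurable_fst.sub measurable_snd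
  have hlaw := hA.isOutcomeLaw (ψ := ψ)
  refine ⟨⟨_, hlaw, fun ν hν => hν.eq hlaw⟩, ?_⟩
  obtain ⟨h1, h2⟩ := memLp_fst_snd hρ hN
  rw [outcomeLaw_eq hlaw, integrable_map_measure (by fun_prop) hm.aemeasurable]
  exact (h1.sub h2).integrable_sq

/-- The outcome is a difference of the two coordinates of a product measure. These are independent,
so the variances add, and the minus sign does not affect them. -/
theorem HasNoiseLaw.obsVar_eq (hA : HasNoiseLaw law A N)
    (hρ : Integrable (fun x => x ^ 2) (law ψ)) (hN : Integrable (fun x => x ^ 2) N) :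
    obsVar A ψ = ProbabilityTheory.variance id (law ψ) + ProbabilityTheory.variance id N := by
  have hm : Measurable fun z : ℝ × ℝ => z.1 - z.2 := measurable_fst.sub measurable_snd
  obtain ⟨h1, h2⟩ := memLp_fst_snd hρ hN
  have hvar : obsVar A ψ = ProbabilityTheory.variance id (outcomeLaw A ψ) := by
    rw [ProbabilityTheory.variance_eq_integral aemeasurable_id]
    rfl
  have hind : ProbabilityTheory.IndepFun (fun z : ℝ × ℝ => z.1) (-fun z : ℝ × ℝ => z.2)
      ((law ψ).prod N) :=
    ProbabilityTheory.indepFun_prod (X := id) (Y := fun t : ℝ => -t) measurable_id measurable_neg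
  have hv1 : ProbabilityTheory.variance (fun z : ℝ × ℝ => z.1) ((law ψ).prod N) =
      ProbabilityTheory.variance id (law ψ) := by
    have h3 := ProbabilityTheory.variance_map (X := id) (Y := Prod.fst) (μ := (law ψ).prod N)
      aemeasurable_id measurable_fst.aemeasurable
    rw [Measure.map_fst_prod, measure_univ, one_smul] at h3
    exact h3.symm
  have hv2 : ProbabilityTheory.variance (fun z : ℝ × ℝ => z.2) ((law ψ).prod N) =
      ProbabilityTheory.variance id N := by
    have h3 := ProbabilityTheory.variance_map (X := id) (Y := Prod.snd) (μ := (law ψ).prod N)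
      aemeasurable_id measurable_snd.aemeasurable
    rw [Measure.map_snd_prod, measure_univ, one_smul] at h3
    exact h3.symm
  have hadd := hind.variance_add h1 h2.neg
  rw [ProbabilityTheory.variance_neg, hv1, hv2] at hadd
  rw [hvar, outcomeLaw_eq hA.isOutcomeLaw,
    ProbabilityTheory.variance_map aemeasurable_id hm.aemeasurable, ← hadd]
  congr 1

end NoiseLaw

/-! ### Moments of linear combinations -/

section Moments

variable {P : Measure (Conf 2)}

theorem integral_linear_noise {i j : Fin 2} (a b : ℝ)
    (h : ∀ k : Fin 2, Integrable (fun y => y k) P) :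
    Integrable (fun y : Conf 2 => a * y i - b * y j) P ∧
      ∫ y, (a * y i - b * y j) ∂P = a * ∫ y, y i ∂P - b * ∫ y, y j ∂P := by
  have h1 := (h i).const_mul a
  have h2 := (h j).const_mul b
  exact ⟨h1.sub h2, by rw [integral_sub h1 h2, integral_const_mul, integral_const_mul]⟩

theorem memLp_coord (h : ∀ k : Fin 2, Integrable (fun y => y k ^ 2) P) (k : Fin 2) :
    MemLp (fun y : Conf 2 => y k) 2 P :=
  (memLp_two_iff_integrable_sq (measurable_conf_coord k).aestronglyMeasurable).2 (h k)

theorem integrable_coord [IsFiniteMeasure P] (h : ∀ k : Fin 2, Integrable (fun y => y k ^ 2) P) (k : Fin 2) :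
    Integrable (fun y : Conf 2 => y k) P :=
  (memLp_coord h k).integrable (by norm_num)

theorem integral_linear_noise_sq {i j : Fin 2} (a b : ℝ)
    (h : ∀ k : Fin 2, Integrable (fun y => y k ^ 2) P) :
    Integrable (fun y : Conf 2 => (a * y i - b * y j) ^ 2) P ∧
      ∫ y, (a * y i - b * y j) ^ 2 ∂P = a ^ 2 * ∫ y, y i ^ 2 ∂P + b ^ 2 * ∫ y, y j ^ 2 ∂P
        - 2 * a * b * ∫ y, y i * y j ∂P := by
  have h1 := (h i).const_mul (a ^ 2)
  have h2 := (h j).const_mul (b ^ 2)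
  have h3 := ((memLp_coord h i).integrable_mul (memLp_coord h j)).const_mul (2 * a * b)
  simp only [Pi.mul_apply] at h3
  have he : (fun y : Conf 2 => (a * y i - b * y j) ^ 2) = fun y : Conf 2 =>
      a ^ 2 * y i ^ 2 + b ^ 2 * y j ^ 2 - 2 * a * b * (y i * y j) := by
    funext y; ring
  rw [he]
  exact ⟨(h1.add h2).sub h3, by
    have h4 := integral_sub (h1.add h2) h3
    simp only [Pi.add_apply] at h4
    rw [h4, integral_add h1 h2, integral_const_mul, integral_const_mul,
      integral_const_mul]⟩

theorem integral_map_noise {n : Conf 2 → ℝ} (hn : Measurable n) {g : ℝ → ℝ} (hg : Measurable g) :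
    ∫ q, g q ∂P.map n = ∫ y, g (n y) ∂P :=
  integral_map hn.aemeasurable hg.aestronglyMeasurable

theorem integrable_map_noise {n : Conf 2 → ℝ} (hn : Measurable n) {g : ℝ → ℝ}
    (hg : Measurable g) : Integrable g (P.map n) ↔ Integrable (fun y => g (n y)) P :=
  integrable_map_measure hg.aestronglyMeasurable hn.aemeasurable

theorem variance_map_noise [IsProbabilityMeasure P] {n : Conf 2 → ℝ} (hn : Measurable n)
    (h : Integrable (fun y => n y ^ 2) P) :
    ProbabilityTheory.variance id (P.map n) = ∫ y, n y ^ 2 ∂P - (∫ y, n y ∂P) ^ 2 := by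
  rw [ProbabilityTheory.variance_map aemeasurable_id hn.aemeasurable]
  exact ProbabilityTheory.variance_eq_sub
    ((memLp_two_iff_integrable_sq hn.aestronglyMeasurable).2 h)

end Moments

/-! ### Phase space displacements -/

section Displacement

variable {E : Type*} [NormedAddCommGroup E] [InnerProductSpace ℝ E]

/-- The displaced wave function `x ↦ exp(2πi⟨η, x⟩) f(x - v)`. -/
def displace (v η : E) (f : E → ℂ) (x : E) : ℂ := 𝐞 (inner ℝ η x) • f (x - v)

theorem norm_displace (v η : E) (f : E → ℂ) (x : E) : ‖displace v η f x‖ = ‖f (x - v)‖ :=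
  Circle.norm_smul _ _

theorem continuous_displace (v η : E) {f : E → ℂ} (hf : Continuous f) :
    Continuous (displace v η f) := by
  unfold displace
  simp only [Circle.smul_def]
  have h1 : Continuous fun x : E => 𝐞 (inner ℝ η x) :=
    Real.continuous_fourierChar.comp (continuous_const.inner continuous_id)
  exact (continuous_subtype_val.comp h1).smul (hf.comp (continuous_id.sub continuous_const))

variable [FiniteDimensional ℝ E] [MeasurableSpace E] [BorelSpace E]

theorem measurePreserving_sub_const (v : E) :
    MeasurePreserving (fun x : E => x - v) volume volume :=
  measurePreserving_sub_right volume v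

theorem integrable_displace (v η : E) (f : 𝓢(E, ℂ)) : Integrable (displace v η f) := by
  refine (integrable_norm_iff (continuous_displace v η f.continuous).aestronglyMeasurable).1 ?_
  simp only [norm_displace]
  exact ((measurePreserving_sub_const v).integrable_comp_of_integrable f.integrable).norm

theorem memLp_displace (v η : E) (f : 𝓢(E, ℂ)) : MemLp (displace v η f) 2 volume := by
  refine ((f.memLp 2 volume).comp_measurePreserving (measurePreserving_sub_const v)).of_le
    (continuous_displace v η f.continuous).aestronglyMeasurable
    (Filter.Eventually.of_forall fun x => ?_)
  rw [norm_displace]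
  rfl

theorem norm_toLp_displace (v η : E) (f : 𝓢(E, ℂ)) :
    ‖(memLp_displace v η f).toLp _‖ = ‖f.toLp 2 volume‖ := by
  rw [Lp.norm_toLp, SchwartzMap.norm_toLp,
    ← eLpNorm_comp_measurePreserving f.continuous.aestronglyMeasurable
      (measurePreserving_sub_const v)]
  congr 1
  exact eLpNorm_congr_norm_ae (Filter.Eventually.of_forall fun x => norm_displace v η f x)

/-- The Fourier transform exchanges translations and modulations: `v` contributes only a phase,
while `η` shifts the argument. -/
theorem norm_fourier_displace (v η : E) (f : E → ℂ) (ξ : E) :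
    ‖𝓕 (displace v η f) ξ‖ = ‖𝓕 f (ξ - η)‖ := by
  rw [Real.fourier_eq, Real.fourier_eq]
  have h1 : ∫ x, 𝐞 (-inner ℝ x ξ) • displace v η f x =
      𝐞 (-inner ℝ v (ξ - η)) • ∫ x, 𝐞 (-inner ℝ x (ξ - η)) • f x := by
    have h2 := integral_sub_right_eq_self (μ := (volume : Measure E))
      (fun y => 𝐞 (-inner ℝ v (ξ - η)) • 𝐞 (-inner ℝ y (ξ - η)) • f y) v
    rw [Circle.smul_def, ← integral_smul]
    refine Eq.trans ?_ h2
    refine integral_congr_ae (Filter.Eventually.of_forall fun x => ?_)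
    simp only [displace, smul_smul, ← AddChar.map_add_eq_mul]
    congr 2
    simp only [inner_sub_left, inner_sub_right, real_inner_comm η x]
    ring
  rw [h1, Circle.norm_smul]

theorem withDensity_sub_eq_map {h : E → ℂ} (hh : Measurable h) (v : E) :
    (volume : Measure E).withDensity (fun x => ‖h (x - v)‖ₑ ^ 2) =
      (volume.withDensity fun x => ‖h x‖ₑ ^ 2).map fun x => x + v := by
  have h1 := map_withDensity_comp (μ := (volume : Measure E)) (f := fun x => x + v)
    (measurable_add_const v) (g := fun x => ‖h (x - v)‖ₑ ^ 2)
    ((hh.comp (measurable_sub_const v)).enorm.pow_const 2)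
  simp only [add_sub_cancel_right] at h1
  rw [h1, map_add_right_eq_self]

theorem posLaw_displace (v η : E) (f : 𝓢(E, ℂ)) :
    posLaw ((memLp_displace v η f).toLp _) =
      (posLaw (f.toLp 2 volume)).map fun x => x + v := by
  rw [posLaw_eq_of_ae_eq (memLp_displace v η f).coeFn_toLp,
    posLaw_eq_of_ae_eq (f.coeFn_toLp 2 volume),
    ← withDensity_sub_eq_map f.continuous.measurable v]
  congr 1
  funext x
  rw [← ofReal_norm, norm_displace, ofReal_norm]

theorem momLaw_displace (v η : E) (f : 𝓢(E, ℂ)) :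
    momLaw ((memLp_displace v η f).toLp _) =
      (momLaw (f.toLp 2 volume)).map fun p => p + (2 * Real.pi) • η := by
  have h0 : (Lp.fourierTransformₗᵢ E ℂ (f.toLp 2 volume) : L2 E) =ᵐ[volume]
      (𝓕 f : 𝓢(E, ℂ)) := by
    have h1 : Lp.fourierTransformₗᵢ E ℂ (f.toLp 2 volume) = (𝓕 f).toLp 2 volume :=
      SchwartzMap.toLp_fourier_eq f
    rw [h1]
    exact (𝓕 f).coeFn_toLp 2 volume
  have h1 : posLaw (Lp.fourierTransformₗᵢ E ℂ ((memLp_displace v η f).toLp _)) =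
      (posLaw (Lp.fourierTransformₗᵢ E ℂ (f.toLp 2 volume))).map fun ξ => ξ + η := by
    rw [posLaw_eq_of_ae_eq
      (fourierTransform_toLp_ae_eq (integrable_displace v η f) (memLp_displace v η f)),
      posLaw_eq_of_ae_eq h0, ← withDensity_sub_eq_map (𝓕 f).continuous.measurable η]
    congr 1
    funext ξ
    rw [← ofReal_norm, norm_fourier_displace, ofReal_norm, SchwartzMap.fourier_coe]
  rw [momLaw_eq_map, momLaw_eq_map, h1,
    Measure.map_map (measurable_const_smul _) (measurable_add_const η),
    Measure.map_map (measurable_add_const _) (measurable_const_smul _)]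
  congr 1
  funext ξ
  simp

end Displacement

/-! ### Schwartz states: finite second moments and normalization. -/

theorem integrable_sq_posLaw_toLp {n : ℕ} (f : 𝓢(Conf n, ℂ)) (j : Fin n) :
    Integrable (fun x : Conf n => x j ^ 2) (posLaw (f.toLp 2 volume)) := by
  have hm : Measurable fun x => ‖f x‖ₑ ^ 2 := f.continuous.measurable.enorm.pow_const 2
  rw [posLaw_eq_of_ae_eq (f.coeFn_toLp 2 volume),
    integrable_withDensity_iff_integrable_smul₀' hm.aemeasurable
      (Filter.Eventually.of_forall fun x => by simp [enorm_lt_top])]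
  -- The integrand is `|x_j f|²`, and `x_j f` is again a Schwartz function.
  refine ((posOp j f).memLp 2 volume).integrable_norm_pow (by norm_num) |>.congr
    (Filter.Eventually.of_forall fun x => ?_)
  simp only [posOp_apply, norm_mul, mul_pow, Complex.norm_real, Real.norm_eq_abs, sq_abs,
    ENNReal.toReal_pow, toReal_enorm, smul_eq_mul]
  ring

theorem integrable_sq_momLaw_toLp {n : ℕ} (f : 𝓢(Conf n, ℂ)) (j : Fin n) :
    Integrable (fun p : Conf n => p j ^ 2) (momLaw (f.toLp 2 volume)) := by
  have h1 : Lp.fourierTransformₗᵢ (Conf n) ℂ (f.toLp 2 volume) = (𝓕 f).toLp 2 volume :=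
    SchwartzMap.toLp_fourier_eq f
  have hm : Measurable fun p : Conf n => p j ^ 2 := (measurable_conf_coord j).pow_const 2
  rw [momLaw_eq_map, h1, integrable_map_measure hm.aestronglyMeasurable
    (measurable_const_smul _).aemeasurable]
  refine ((integrable_sq_posLaw_toLp (𝓕 f) j).const_mul ((2 * Real.pi) ^ 2)).congr
    (Filter.Eventually.of_forall fun x => ?_)
  simp [mul_pow]

theorem exists_schwartz_norm_eq_one (n : ℕ) : ∃ f : 𝓢(Conf n, ℂ), ‖f.toLp 2 volume‖ = 1 := by
  let b : ContDiffBump (0 : Conf n) := ⟨1, 2, one_pos, one_lt_two⟩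
  have h₁ : HasCompactSupport (Complex.ofRealCLM ∘ b) := b.hasCompactSupport.comp_left rfl
  have h₂ : ContDiff ℝ (⊤ : ℕ∞) (Complex.ofRealCLM ∘ b) :=
    Complex.ofRealCLM.contDiff.comp b.contDiff
  let g : 𝓢(Conf n, ℂ) := h₁.toSchwartzMap h₂
  have hg : g ≠ 0 := by
    intro h
    have h0 : g 0 = 0 := by rw [h]; rfl
    have h1 : g 0 = ((b 0 : ℝ) : ℂ) := rfl
    rw [h1, b.one_of_mem_closedBall (by simp [b])] at h0
    simp at h0
  have hgL : g.toLp 2 (volume : Measure (Conf n)) ≠ 0 := by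
    intro h
    refine hg (SchwartzMap.injective_toLp 2 (volume : Measure (Conf n)) ?_)
    exact h.trans (map_zero (SchwartzMap.toLpCLM ℂ (E := Conf n) ℂ 2 volume)).symm
  refine ⟨((‖g.toLp 2 (volume : Measure (Conf n))‖⁻¹ : ℝ) : ℂ) • g, ?_⟩
  have h3 : (((‖g.toLp 2 (volume : Measure (Conf n))‖⁻¹ : ℝ) : ℂ) • g).toLp 2 volume
      = ((‖g.toLp 2 (volume : Measure (Conf n))‖⁻¹ : ℝ) : ℂ) • g.toLp 2 volume :=
    map_smul (SchwartzMap.toLpCLM ℂ (E := Conf n) ℂ 2 volume) _ g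
  rw [h3, norm_smul, Complex.norm_real, Real.norm_of_nonneg (by positivity),
    inv_mul_cancel₀ (norm_ne_zero_iff.2 hgL)]

/-! ### Mixtures of two opposite displacements -/

/-- The equal mixture of the translates of `P` by `v` and `-v`. -/
def symmMix (P : Measure (Conf 2)) (v : Conf 2) : Measure (Conf 2) :=
  ENNReal.ofReal (1 / 2) • P.map (fun y => y + v) + ENNReal.ofReal (1 / 2) • P.map fun y => y + -v

section SymmMix

variable {P : Measure (Conf 2)} {v : Conf 2} {g : Conf 2 → ℝ}

theorem integrable_map_add (hg : Measurable g) (u : Conf 2)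
    (h : Integrable (fun y => g (y + u)) P) :
    Integrable g (ENNReal.ofReal (1 / 2) • P.map fun y => y + u) :=
  ((integrable_map_measure hg.aestronglyMeasurable
    (measurable_add_const u).aemeasurable).2 h).smul_measure ENNReal.ofReal_ne_top

theorem integrable_symmMix (hg : Measurable g) (h : ∀ u, Integrable (fun y => g (y + u)) P) :
    Integrable g (symmMix P v) :=
  (integrable_map_add hg v (h v)).add_measure (integrable_map_add hg (-v) (h (-v)))

theorem integral_symmMix (hg : Measurable g) (h : ∀ u, Integrable (fun y => g (y + u)) P) :
    ∫ y, g y ∂symmMix P v = 1 / 2 * ∫ y, g (y + v) ∂P + 1 / 2 * ∫ y, g (y + -v) ∂P := by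
  rw [symmMix, integral_add_measure (integrable_map_add hg v (h v))
    (integrable_map_add hg (-v) (h (-v))), integral_smul_measure, integral_smul_measure,
    integral_map (measurable_add_const v).aemeasurable hg.aestronglyMeasurable,
    integral_map (measurable_add_const (-v)).aemeasurable hg.aestronglyMeasurable,
    ENNReal.toReal_ofReal (by norm_num), smul_eq_mul, smul_eq_mul]

variable [IsProbabilityMeasure P]

theorem integral_add_mul_add
    (hP : ∀ k : Fin 2, Integrable (fun y : Conf 2 => y k ^ 2) P) (u : Conf 2) (j k : Fin 2) :
    Integrable (fun y : Conf 2 => (y + u) j * (y + u) k) P ∧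
      ∫ y : Conf 2, (y + u) j * (y + u) k ∂P =
        ∫ y, y j * y k ∂P + u k * ∫ y, y j ∂P + u j * ∫ y, y k ∂P + u j * u k := by
  have h1 := (memLp_coord hP j).integrable_mul (memLp_coord hP k)
  have h2 := (integrable_coord hP j).const_mul (u k)
  have h3 := (integrable_coord hP k).const_mul (u j)
  have h4 : Integrable (fun _ : Conf 2 => u j * u k) P := integrable_const _
  have he : (fun y : Conf 2 => (y + u) j * (y + u) k) = fun y : Conf 2 =>
      y j * y k + u k * y j + u j * y k + u j * u k := by
    funext y
    simp only [PiLp.add_apply]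
    ring
  simp only [he]
  refine ⟨((h1.add h2).add h3).add h4, ?_⟩
  have i1 := integral_add ((h1.add h2).add h3) h4
  have i2 := integral_add (h1.add h2) h3
  have i3 := integral_add h1 h2
  simp only [Pi.add_apply, Pi.mul_apply] at i1 i2 i3
  rw [i1, i2, i3, integral_const_mul, integral_const_mul]
  simp

theorem integral_add_coord
    (hP : ∀ k : Fin 2, Integrable (fun y : Conf 2 => y k ^ 2) P) (u : Conf 2) (j : Fin 2) :
    Integrable (fun y : Conf 2 => (y + u) j) P ∧
      ∫ y : Conf 2, (y + u) j ∂P = ∫ y, y j ∂P + u j := by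
  have h4 : Integrable (fun _ : Conf 2 => u j) P := integrable_const _
  simp only [PiLp.add_apply]
  exact ⟨(integrable_coord hP j).add h4, by
    rw [integral_add (integrable_coord hP j) h4]; simp⟩

theorem integrable_sq_symmMix
    (hP : ∀ k : Fin 2, Integrable (fun y : Conf 2 => y k ^ 2) P) (j : Fin 2) :
    Integrable (fun y : Conf 2 => y j ^ 2) (symmMix P v) :=
  integrable_symmMix ((measurable_conf_coord j).pow_const 2) fun u => by
    simpa only [sq] using (integral_add_mul_add hP u j j).1

theorem integral_coord_symmMix
    (hP : ∀ k : Fin 2, Integrable (fun y : Conf 2 => y k ^ 2) P) (j : Fin 2) :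
    ∫ y, y j ∂symmMix P v = ∫ y, y j ∂P := by
  rw [integral_symmMix (measurable_conf_coord j) fun u => (integral_add_coord hP u j).1,
    (integral_add_coord hP v j).2, (integral_add_coord hP (-v) j).2, PiLp.neg_apply]
  ring

/-- The terms linear in the displacement cancel between `v` and `-v`. As the means are unchanged
too, the covariance matrix gains exactly `v j * v k`. -/
theorem integral_mul_symmMix
    (hP : ∀ k : Fin 2, Integrable (fun y : Conf 2 => y k ^ 2) P) (j k : Fin 2) :
    ∫ y, y j * y k ∂symmMix P v = ∫ y, y j * y k ∂P + v j * v k := by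
  have hm : Measurable fun y : Conf 2 => y j * y k :=
    (measurable_conf_coord j).mul (measurable_conf_coord k)
  rw [integral_symmMix hm fun u => (integral_add_mul_add hP u j k).1,
    (integral_add_mul_add hP v j k).2, (integral_add_mul_add hP (-v) j k).2, PiLp.neg_apply,
    PiLp.neg_apply]
  ring

theorem integral_sq_symmMix
    (hP : ∀ k : Fin 2, Integrable (fun y : Conf 2 => y k ^ 2) P) (j : Fin 2) :
    ∫ y, y j ^ 2 ∂symmMix P v = ∫ y, y j ^ 2 ∂P + v j ^ 2 := by
  simpa only [sq] using integral_mul_symmMix hP j j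

end SymmMix

/-- The equal mixture of two opposite displacements of a pure probe state. -/
def displacedPair (f : 𝓢(Conf 2, ℂ)) (hf : ‖f.toLp 2 volume‖ = 1) (v η : Conf 2) :
    ProbeState (Fin 2) where
  weight _ := 1 / 2
  vec := ![(memLp_displace v η f).toLp _, (memLp_displace (-v) (-η) f).toLp _]
  weight_nonneg _ := by norm_num
  weight_sum := by
    have h := hasSum_fintype (fun _ : Fin 2 => (1 / 2 : ℝ))
    norm_num at h
    simpa using h
  norm_vec i := by
    fin_cases i
    · exact (norm_toLp_displace v η f).trans hf
    · exact (norm_toLp_displace (-v) (-η) f).trans hf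

theorem posLaw_displacedPair (f : 𝓢(Conf 2, ℂ)) (hf : ‖f.toLp 2 volume‖ = 1) (v η : Conf 2) :
    (displacedPair f hf v η).posLaw = symmMix (posLaw (f.toLp 2 volume)) v := by
  rw [ProbeState.posLaw, Measure.sum_fintype, Fin.sum_univ_two, symmMix, ← posLaw_displace v η,
    ← posLaw_displace (-v) (-η)]
  rfl

theorem momLaw_displacedPair (f : 𝓢(Conf 2, ℂ)) (hf : ‖f.toLp 2 volume‖ = 1) (v η : Conf 2) :
    (displacedPair f hf v η).momLaw =
      symmMix (momLaw (f.toLp 2 volume)) ((2 * Real.pi) • η) := by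
  rw [ProbeState.momLaw, Measure.sum_fintype, Fin.sum_univ_two, symmMix, ← momLaw_displace v η,
    ← smul_neg, ← momLaw_displace (-v) (-η)]
  rfl

/-- Here `d` stands for `1 - kap` or `1 + kap`, `V` for the variance and `L` for the covariance to
be realized. Choosing `L` with the sign of `d` and large enough makes the linear term win; for `d =
0` only `L ≠ 0` is required. -/
theorem exists_negative_combination (d V : ℝ) {a b : ℝ} (hb : 0 < b) :
    ∃ L : ℝ, L ≠ 0 ∧ (d ≠ 0 → d ^ 2 * a * V - d * b * L < 0) := by
  by_cases hd : d = 0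
  · exact ⟨1, one_ne_zero, fun h => absurd hd h⟩
  have ht : 0 < (|a * V| + 1) / b := by positivity
  refine ⟨d * ((|a * V| + 1) / b), mul_ne_zero hd ht.ne', fun _ => ?_⟩
  have h1 : d ^ 2 * a * V - d * b * (d * ((|a * V| + 1) / b)) = d ^ 2 * (a * V - |a * V| - 1) := by
    field_simp
    ring
  rw [h1]
  have h2 := le_abs_self (a * V)
  have h3 : 0 < d ^ 2 := by positivity
  exact mul_neg_of_pos_of_neg h3 (by linarith)

/-! ### Moments of the noise densities -/

section LinearNoise

variable {P : Measure (Conf 2)} {n : Conf 2 → ℝ} {a b : ℝ} {i j : Fin 2} {e : ℝ → ℝ}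

theorem measurable_linear_noise (hn : ∀ y, n y = a * y i - b * y j) : Measurable n := by
  rw [show n = fun y => a * y i - b * y j from funext hn]
  fun_prop

theorem IsDensityOf.first_moment (he : IsDensityOf e (P.map n))
    (hn : ∀ y, n y = a * y i - b * y j) (h : ∀ k : Fin 2, Integrable (fun y => y k) P) :
    Integrable (fun q => q * e q) ∧ moment1 e = a * ∫ y, y i ∂P - b * ∫ y, y j ∂P := by
  have hnm := measurable_linear_noise hn
  obtain ⟨h1, h2⟩ := integral_linear_noise (i := i) (j := j) a b h
  refine ⟨he.integrable_iff.1 ((integrable_map_noise hnm measurable_id).2 ?_), ?_⟩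
  · simpa only [id, hn] using h1
  · rw [he.moment1_eq, integral_map_noise hnm measurable_id', ← h2]
    simp only [hn]

theorem integrable_sq_map_noise (hn : ∀ y, n y = a * y i - b * y j)
    (h : ∀ k : Fin 2, Integrable (fun y => y k ^ 2) P) :
    Integrable (fun q => q ^ 2) (P.map n) := by
  rw [integrable_map_noise (measurable_linear_noise hn) (measurable_id'.pow_const 2)]
  simpa only [hn] using (integral_linear_noise_sq (i := i) (j := j) a b h).1

theorem IsDensityOf.second_moment (he : IsDensityOf e (P.map n))
    (hn : ∀ y, n y = a * y i - b * y j) (h : ∀ k : Fin 2, Integrable (fun y => y k ^ 2) P) :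
    Integrable (fun q => q ^ 2 * e q) ∧
      moment2 e = a ^ 2 * ∫ y, y i ^ 2 ∂P + b ^ 2 * ∫ y, y j ^ 2 ∂P
        - 2 * a * b * ∫ y, y i * y j ∂P := by
  have hnm := measurable_linear_noise hn
  refine ⟨he.integrable_iff.1 (integrable_sq_map_noise hn h), ?_⟩
  rw [he.moment2_eq, integral_map_noise hnm (measurable_id'.pow_const 2),
    ← (integral_linear_noise_sq (i := i) (j := j) a b h).2]
  simp only [hn]

theorem IsDensityOf.variance [IsProbabilityMeasure P] (he : IsDensityOf e (P.map n))
    (hn : ∀ y, n y = a * y i - b * y j) (h : ∀ k : Fin 2, Integrable (fun y => y k ^ 2) P) :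
    densityVar e = a ^ 2 * (∫ y, y i ^ 2 ∂P - (∫ y, y i ∂P) ^ 2)
      + b ^ 2 * (∫ y, y j ^ 2 ∂P - (∫ y, y j ∂P) ^ 2)
      - 2 * a * b * (∫ y, y i * y j ∂P - (∫ y, y i ∂P) * ∫ y, y j ∂P) := by
  have hnm := measurable_linear_noise hn
  have h2 := integral_linear_noise_sq (i := i) (j := j) a b h
  have h1 := integral_linear_noise (i := i) (j := j) a b (integrable_coord h)
  have : IsProbabilityMeasure (P.map n) := Measure.isProbabilityMeasure_map hnm.aemeasurable
  rw [he.densityVar_eq, variance_map_noise hnm (by simpa only [hn] using h2.1)]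
  simp only [hn]
  rw [h2.2, h1.2]
  ring

end LinearNoise

/-- The change of the variance when one additive noise is replaced by another. -/
theorem HasNoiseLaw.obsVar_sub {law : L2 ℝ → Measure ℝ} {A A₀ : Set ℝ → (L2 ℝ →L[ℂ] L2 ℝ)}
    {N N₀ : Measure ℝ} [IsProbabilityMeasure N] [IsProbabilityMeasure N₀]
    (hA : HasNoiseLaw law A N) (hA₀ : HasNoiseLaw law A₀ N₀) {e e₀ : ℝ → ℝ}
    (he : IsDensityOf e N) (he₀ : IsDensityOf e₀ N₀) {ψ : L2 ℝ} [IsProbabilityMeasure (law ψ)]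
    (hψ : Integrable (fun x => x ^ 2) (law ψ)) (hN : Integrable (fun x => x ^ 2) N)
    (hN₀ : Integrable (fun x => x ^ 2) N₀) :
    obsVar A ψ - obsVar A₀ ψ = densityVar e - densityVar e₀ := by
  rw [hA.obsVar_eq hψ hN, hA₀.obsVar_eq hψ hN₀, he.densityVar_eq, he₀.densityVar_eq]
  ring

/-! ### Variances of the noises and Di Lorenzo's quantities. -/

section Disturbance

variable {ι : Type*} [Countable ι] (σ : ProbeState ι)

instance isProbabilityMeasure_noiseQ (lam mu kap : ℝ) :
    IsProbabilityMeasure (σ.posLaw.map (noiseQ lam mu kap)) :=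
  Measure.isProbabilityMeasure_map (measurable_noiseQ lam mu kap).aemeasurable

instance isProbabilityMeasure_noiseP (lam mu kap : ℝ) :
    IsProbabilityMeasure (σ.momLaw.map (noiseP lam mu kap)) :=
  Measure.isProbabilityMeasure_map (measurable_noiseP lam mu kap).aemeasurable

variable {lam mu : ℝ} (kap : ℝ)

theorem densityVar_noiseE (hlam : 0 < lam) (hmu : 0 < mu) (hQ : σ.SecondMomentsQ) :
    densityVar (noiseE lam mu kap σ) =
      1 / lam ^ 2 * σ.varQ 0 + mu ^ 2 / 4 * (1 - kap) ^ 2 * σ.varQ 1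
        - mu / lam * (1 - kap) * σ.covQ := by
  rw [(isDensityOf_noiseE hlam hmu kap σ).variance (fun y => rfl) hQ]
  simp only [ProbeState.varQ, ProbeState.covQ, ProbeState.avgQ, mul_comm]
  ring

theorem densityVar_noiseE0 (hlam : 0 < lam) (hQ : σ.SecondMomentsQ) :
    densityVar (noiseE0 lam σ) = 1 / lam ^ 2 * σ.varQ 0 := by
  -- At `mu = 0` the function `noiseQ` does not depend on `kap`, so the value `0` is as good as any.
  rw [(isDensityOf_noiseE0 hlam 0 σ).variance (fun y => rfl) hQ]
  simp only [ProbeState.varQ, ProbeState.avgQ]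
  ring

theorem densityVar_noiseF (hlam : 0 < lam) (hmu : 0 < mu) (hP : σ.SecondMomentsP) :
    densityVar (noiseF lam mu kap σ) =
      lam ^ 2 / 4 * (1 + kap) ^ 2 * σ.varP 0 + 1 / mu ^ 2 * σ.varP 1
        - lam / mu * (1 + kap) * σ.covP := by
  rw [(isDensityOf_noiseF hlam hmu kap σ).variance (fun y => rfl) hP]
  simp only [ProbeState.varP, ProbeState.covP, ProbeState.avgP]
  ring

theorem densityVar_noiseF0 (hmu : 0 < mu) (hP : σ.SecondMomentsP) :
    densityVar (noiseF0 mu σ) = 1 / mu ^ 2 * σ.varP 1 := by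
  rw [(isDensityOf_noiseF0 hmu 0 σ).variance (fun y => rfl) hP]
  simp only [ProbeState.varP, ProbeState.avgP]
  ring

theorem disturbance_position (hlam : 0 < lam) (hmu : 0 < mu) (hQ : σ.SecondMomentsQ) {ψ : L2 ℝ}
    (hψ : ‖ψ‖ = 1) (hψ2 : Integrable (fun x => x ^ 2) (posLaw ψ)) :
    HasFiniteVar (obsE lam mu kap σ) ψ ∧ HasFiniteVar (obsE0 lam kap σ) ψ ∧
      deltaQ lam mu kap σ ψ = densityVar (noiseE lam mu kap σ) - densityVar (noiseE0 lam σ) ∧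
      deltaQ lam mu kap σ ψ =
        (1 - kap) ^ 2 / 4 * mu ^ 2 * σ.varQ 1 - (1 - kap) / lam * mu * σ.covQ := by
  have := isProbabilityMeasure_posLaw hψ
  have hE := hasNoiseLaw_obsE hlam.ne' hmu.ne' kap σ
  have hE0 := hasNoiseLaw_obsE0 hlam.ne' kap σ
  have hN : Integrable (fun q => q ^ 2) (σ.posLaw.map (noiseQ lam mu kap)) :=
    integrable_sq_map_noise (fun y => rfl) hQ
  have hN0 : Integrable (fun q => q ^ 2) (σ.posLaw.map (noiseQ lam 0 kap)) :=
    integrable_sq_map_noise (fun y => rfl) hQ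
  have hd : deltaQ lam mu kap σ ψ =
      densityVar (noiseE lam mu kap σ) - densityVar (noiseE0 lam σ) :=
    hE.obsVar_sub hE0 (isDensityOf_noiseE hlam hmu kap σ) (isDensityOf_noiseE0 hlam kap σ)
      hψ2 hN hN0
  refine ⟨hE.hasFiniteVar hψ2 hN, hE0.hasFiniteVar hψ2 hN0, hd, ?_⟩
  rw [hd, densityVar_noiseE σ kap hlam hmu hQ, densityVar_noiseE0 σ hlam hQ]
  ring

theorem disturbance_momentum (hlam : 0 < lam) (hmu : 0 < mu) (hP : σ.SecondMomentsP) {ψ : L2 ℝ}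
    (hψ : ‖ψ‖ = 1) (hψ2 : Integrable (fun p => p ^ 2) (momLaw ψ)) :
    HasFiniteVar (obsF lam mu kap σ) ψ ∧ HasFiniteVar (obsF0 mu kap σ) ψ ∧
      deltaP lam mu kap σ ψ = densityVar (noiseF lam mu kap σ) - densityVar (noiseF0 mu σ) ∧
      deltaP lam mu kap σ ψ =
        (1 + kap) ^ 2 / 4 * lam ^ 2 * σ.varP 0 - (1 + kap) / mu * lam * σ.covP := by
  have := isProbabilityMeasure_momLaw hψ
  have hF := hasNoiseLaw_obsF hlam.ne' hmu.ne' kap σ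
  have hF0 := hasNoiseLaw_obsF0 hmu.ne' kap σ
  have hN : Integrable (fun q => q ^ 2) (σ.momLaw.map (noiseP lam mu kap)) :=
    integrable_sq_map_noise (fun y => rfl) hP
  have hN0 : Integrable (fun q => q ^ 2) (σ.momLaw.map (noiseP 0 mu kap)) :=
    integrable_sq_map_noise (fun y => rfl) hP
  have hd : deltaP lam mu kap σ ψ =
      densityVar (noiseF lam mu kap σ) - densityVar (noiseF0 mu σ) :=
    hF.obsVar_sub hF0 (isDensityOf_noiseF hlam hmu kap σ) (isDensityOf_noiseF0 hmu kap σ)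
      hψ2 hN hN0
  refine ⟨hF.hasFiniteVar hψ2 hN, hF0.hasFiniteVar hψ2 hN0, hd, ?_⟩
  rw [hd, densityVar_noiseF σ kap hlam hmu hP, densityVar_noiseF0 σ hmu hP]
  ring

end Disturbance

/-- Opposite displacements of one pure state, mixed with equal weights, realize probe states with
negative disturbances. -/
theorem exists_negative_disturbance (lam mu kap : ℝ) (hlam : 0 < lam) (hmu : 0 < mu) :
    ∃ σ : ProbeState (Fin 2), σ.SecondMomentsQ ∧ σ.SecondMomentsP ∧
      σ.covQ ≠ 0 ∧ σ.covP ≠ 0 ∧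
      ∀ ψ : L2 ℝ, ‖ψ‖ = 1 →
        (kap ≠ 1 → Integrable (fun x => x ^ 2) (posLaw ψ) → deltaQ lam mu kap σ ψ < 0) ∧
        (kap ≠ -1 → Integrable (fun p => p ^ 2) (momLaw ψ) → deltaP lam mu kap σ ψ < 0) := by
  obtain ⟨f, hf⟩ := exists_schwartz_norm_eq_one 2
  set P := posLaw (f.toLp 2 volume) with hP
  set M := momLaw (f.toLp 2 volume) with hM
  have hPp : IsProbabilityMeasure P := isProbabilityMeasure_posLaw hf
  have hRp : IsProbabilityMeasure M := isProbabilityMeasure_momLaw hf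
  have hP2 : ∀ k, Integrable (fun y : Conf 2 => y k ^ 2) P := integrable_sq_posLaw_toLp f
  have hR2 : ∀ k, Integrable (fun y : Conf 2 => y k ^ 2) M := integrable_sq_momLaw_toLp f
  have hpi : 2 * Real.pi ≠ 0 := by positivity
  -- The summand `1` anticipates the unit displacement of `Q₂` below. The variance of `Q₂` in the
  -- mixture is thus known before the displacement of `Q₁` is chosen; the roles are exchanged for
  -- the momenta.
  obtain ⟨L, hL0, hL⟩ := exists_negative_combination (1 - kap)
    (∫ y, y 1 ^ 2 ∂P + 1 - (∫ y, y 1 ∂P) ^ 2) (a := mu ^ 2 / 4) (b := mu / lam) (by positivity)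
  obtain ⟨K, hK0, hK⟩ := exists_negative_combination (1 + kap)
    (∫ y, y 0 ^ 2 ∂M + 1 - (∫ y, y 0 ∂M) ^ 2) (a := lam ^ 2 / 4) (b := lam / mu) (by positivity)
  -- Mixing adds `v 0 * v 1` to the covariance. With `v 1 = 1`, subtracting the original covariance
  -- from `L` in `v 0` makes the new one equal to `L`.
  let v : Conf 2 := !₂[L - (∫ y, y 0 * y 1 ∂P - (∫ y, y 0 ∂P) * ∫ y, y 1 ∂P), 1]
  let w : Conf 2 := !₂[1, K - (∫ y, y 0 * y 1 ∂M - (∫ y, y 0 ∂M) * ∫ y, y 1 ∂M)]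
  -- A modulation by `η` displaces the momentum by `2πη`, so this choice displaces it by exactly
  -- `w`.
  let σ := displacedPair f hf v ((2 * Real.pi)⁻¹ • w)
  have hσP : σ.posLaw = symmMix P v := posLaw_displacedPair f hf v _
  have hσM : σ.momLaw = symmMix M w := by
    have h := momLaw_displacedPair f hf v ((2 * Real.pi)⁻¹ • w)
    rwa [smul_inv_smul₀ hpi] at h
  have hQ2 : σ.SecondMomentsQ := fun k => by rw [hσP]; exact integrable_sq_symmMix hP2 k
  have hM2 : σ.SecondMomentsP := fun k => by rw [hσM]; exact integrable_sq_symmMix hR2 k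
  have hcovQ : σ.covQ = L := by
    simp only [ProbeState.covQ, ProbeState.avgQ, hσP, integral_mul_symmMix hP2,
      integral_coord_symmMix hP2]
    simp [v]
    ring
  have hcovP : σ.covP = K := by
    simp only [ProbeState.covP, ProbeState.avgP, hσM, integral_mul_symmMix hR2,
      integral_coord_symmMix hR2]
    simp [w]
    ring
  have hvarQ : σ.varQ 1 = ∫ y, y 1 ^ 2 ∂P + 1 - (∫ y, y 1 ∂P) ^ 2 := by
    simp only [ProbeState.varQ, ProbeState.avgQ, hσP,
      integral_sq_symmMix hP2, integral_coord_symmMix hP2]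
    simp [v]
  have hvarP : σ.varP 0 = ∫ y, y 0 ^ 2 ∂M + 1 - (∫ y, y 0 ∂M) ^ 2 := by
    simp only [ProbeState.varP, ProbeState.avgP, hσM,
      integral_sq_symmMix hR2, integral_coord_symmMix hR2]
    simp [w]
  refine ⟨σ, hQ2, hM2, by rwa [hcovQ], by rwa [hcovP], fun ψ hψ => ⟨fun hk hψ2 => ?_,
    fun hk hψ2 => ?_⟩⟩
  · rw [(disturbance_position σ kap hlam hmu hQ2 hψ hψ2).2.2.2, hcovQ, hvarQ]
    have h := hL (sub_ne_zero.2 hk.symm)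
    convert h using 1
    ring
  · rw [(disturbance_momentum σ kap hlam hmu hM2 hψ hψ2).2.2.2, hcovP, hvarP]
    have h := hK (fun h0 => hk (by linarith))
    convert h using 1
    ring

end

end ArthursKelly

theorem mainTheorem2 (lam mu kap : ℝ) (hlam : 0 < lam) (hmu : 0 < mu) :
    -- the coupling unitaries `exp(-iH)` of the joint and of the two single-probe schemes exist
    -- and are determined by the Hamiltonian
    ((∃! U, IsExpNegI (hamiltonian lam mu kap) U) ∧
      (∃! U, IsExpNegI (hamiltonian lam 0 kap) U) ∧
      (∃! U, IsExpNegI (hamiltonian 0 mu kap) U)) ∧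
    (∀ (ι : Type*) [Countable ι] (σ : ProbeState ι),
      -- the marginals are smeared position and momentum observables
      (IsProbDensity (noiseE lam mu kap σ) ∧ IsProbDensity (noiseF lam mu kap σ) ∧
        (∀ X, MeasurableSet X →
          IsFunOfPos (obsE lam mu kap σ X) (smear X (noiseE lam mu kap σ))) ∧
        (∀ Y, MeasurableSet Y →
          IsFunOfMom (obsF lam mu kap σ Y) (smear Y (noiseF lam mu kap σ)))) ∧
      -- so are the observables measured by a single probe
      (IsProbDensity (noiseE0 lam σ) ∧ IsProbDensity (noiseF0 mu σ) ∧
        (∀ X, MeasurableSet X → IsFunOfPos (obsE0 lam kap σ X) (smear X (noiseE0 lam σ))) ∧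
        (∀ Y, MeasurableSet Y → IsFunOfMom (obsF0 mu kap σ Y) (smear Y (noiseF0 mu σ)))) ∧
      -- first moments
      (σ.FirstMomentsQ →
        Integrable (fun q => q * noiseE lam mu kap σ q) ∧
        moment1 (noiseE lam mu kap σ) =
          mu / 2 * (1 - kap) * σ.avgQ (fun x => x 1) - 1 / lam * σ.avgQ (fun x => x 0)) ∧
      (σ.FirstMomentsP →
        Integrable (fun p => p * noiseF lam mu kap σ p) ∧
        moment1 (noiseF lam mu kap σ) =
          lam / 2 * (1 + kap) * σ.avgP (fun p => p 0) - 1 / mu * σ.avgP (fun p => p 1)) ∧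
      -- second moments, variances, and the disturbance of position
      (σ.SecondMomentsQ →
        Integrable (fun q => q ^ 2 * noiseE lam mu kap σ q) ∧
        moment2 (noiseE lam mu kap σ) =
          mu ^ 2 / 4 * (1 - kap) ^ 2 * σ.avgQ (fun x => x 1 ^ 2)
            + 1 / lam ^ 2 * σ.avgQ (fun x => x 0 ^ 2)
            - mu / lam * (1 - kap) * σ.avgQ (fun x => x 0 * x 1) ∧
        densityVar (noiseE lam mu kap σ) =
          1 / lam ^ 2 * σ.varQ 0 + mu ^ 2 / 4 * (1 - kap) ^ 2 * σ.varQ 1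
            - mu / lam * (1 - kap) * σ.covQ ∧
        Integrable (fun q => q ^ 2 * noiseE0 lam σ q) ∧
        densityVar (noiseE0 lam σ) = 1 / lam ^ 2 * σ.varQ 0 ∧
        ∀ ψ : L2 ℝ, ‖ψ‖ = 1 → Integrable (fun x => x ^ 2) (posLaw ψ) →
          HasFiniteVar (obsE lam mu kap σ) ψ ∧ HasFiniteVar (obsE0 lam kap σ) ψ ∧
          deltaQ lam mu kap σ ψ =
            densityVar (noiseE lam mu kap σ) - densityVar (noiseE0 lam σ) ∧
          deltaQ lam mu kap σ ψ =
            (1 - kap) ^ 2 / 4 * mu ^ 2 * σ.varQ 1 - (1 - kap) / lam * mu * σ.covQ) ∧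
      -- second moments, variances, and the disturbance of momentum
      (σ.SecondMomentsP →
        Integrable (fun p => p ^ 2 * noiseF lam mu kap σ p) ∧
        moment2 (noiseF lam mu kap σ) =
          lam ^ 2 / 4 * (1 + kap) ^ 2 * σ.avgP (fun p => p 0 ^ 2)
            + 1 / mu ^ 2 * σ.avgP (fun p => p 1 ^ 2)
            - lam / mu * (1 + kap) * σ.avgP (fun p => p 0 * p 1) ∧
        densityVar (noiseF lam mu kap σ) =
          lam ^ 2 / 4 * (1 + kap) ^ 2 * σ.varP 0 + 1 / mu ^ 2 * σ.varP 1
            - lam / mu * (1 + kap) * σ.covP ∧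
        Integrable (fun p => p ^ 2 * noiseF0 mu σ p) ∧
        densityVar (noiseF0 mu σ) = 1 / mu ^ 2 * σ.varP 1 ∧
        ∀ ψ : L2 ℝ, ‖ψ‖ = 1 → Integrable (fun p => p ^ 2) (momLaw ψ) →
          HasFiniteVar (obsF lam mu kap σ) ψ ∧ HasFiniteVar (obsF0 mu kap σ) ψ ∧
          deltaP lam mu kap σ ψ =
            densityVar (noiseF lam mu kap σ) - densityVar (noiseF0 mu σ) ∧
          deltaP lam mu kap σ ψ =
            (1 + kap) ^ 2 / 4 * lam ^ 2 * σ.varP 0 - (1 + kap) / mu * lam * σ.covP)) ∧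
    -- the disturbances are negative for suitable correlated probes
    (∃ σ : ProbeState (Fin 2), σ.SecondMomentsQ ∧ σ.SecondMomentsP ∧
      σ.covQ ≠ 0 ∧ σ.covP ≠ 0 ∧
      ∀ ψ : L2 ℝ, ‖ψ‖ = 1 →
        (kap ≠ 1 → Integrable (fun x => x ^ 2) (posLaw ψ) → deltaQ lam mu kap σ ψ < 0) ∧
        (kap ≠ -1 → Integrable (fun p => p ^ 2) (momLaw ψ) → deltaP lam mu kap σ ψ < 0)) := by
  refine ⟨⟨existsUnique_isExpNegI_hamiltonian _ _ _, existsUnique_isExpNegI_hamiltonian _ _ _,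
    existsUnique_isExpNegI_hamiltonian _ _ _⟩, fun ι _ σ => ?_,
    exists_negative_disturbance lam mu kap hlam hmu⟩
  have hE := isDensityOf_noiseE hlam hmu kap σ
  have hF := isDensityOf_noiseF hlam hmu kap σ
  have hE0 := isDensityOf_noiseE0 hlam kap σ
  have hF0 := isDensityOf_noiseF0 hmu kap σ
  refine ⟨⟨hE.isProbDensity, hF.isProbDensity,
      fun X hX => (hasNoiseLaw_obsE hlam.ne' hmu.ne' kap σ).isFunOfPos hE hX,
      fun Y hY => (hasNoiseLaw_obsF hlam.ne' hmu.ne' kap σ).isFunOfMom hF hY⟩,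
    ⟨hE0.isProbDensity, hF0.isProbDensity,
      fun X hX => (hasNoiseLaw_obsE0 hlam.ne' kap σ).isFunOfPos hE0 hX,
      fun Y hY => (hasNoiseLaw_obsF0 hmu.ne' kap σ).isFunOfMom hF0 hY⟩,
    fun hQ => hE.first_moment (fun y => rfl) hQ, fun hP => hF.first_moment (fun y => rfl) hP,
    fun hQ => ?_, fun hP => ?_⟩
  · obtain ⟨h1, h2⟩ := hE.second_moment (fun y => rfl) hQ
    refine ⟨h1, ?_, densityVar_noiseE σ kap hlam hmu hQ,
      (hE0.second_moment (fun y => rfl) hQ).1, densityVar_noiseE0 σ hlam hQ,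
      fun ψ hψ hψ2 => disturbance_position σ kap hlam hmu hQ hψ hψ2⟩
    rw [h2]
    simp only [ProbeState.avgQ, mul_comm]
    ring
  · obtain ⟨h1, h2⟩ := hF.second_moment (fun y => rfl) hP
    refine ⟨h1, ?_, densityVar_noiseF σ kap hlam hmu hP,
      (hF0.second_moment (fun y => rfl) hP).1, densityVar_noiseF0 σ hmu hP,
      fun ψ hψ hψ2 => disturbance_momentum σ kap hlam hmu hP hψ hψ2⟩
    rw [h2]
    simp only [ProbeState.avgP]
    ring
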